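/- Let $n\in\mathbb{N}$ (including $n=0$) and consider the gates $$X=\begin{pmatrix}0&1\\1&0\end{pmatrix},\quad H=\tfrac{1}{\sqrt2}\begin{pmatrix}1&1\\1&-1\end{pmatrix},\quad S=\begin{pmatrix}1&0\\0&i\end{pmatrix},\quad CX=I_2\oplus X,\quad CCX=I_6\oplus X .$$ A circuit on $N$ qubits over the gate set $\{X,CX,CCX,H,S\}$ is a finite composition of these gates, each applied to some ordered choice of distinct qubits among the $N$ and acting as the identity on the others; it is identified with its $2^N\times 2^N$ matrix. A $2^n\times 2^n$ complex matrix $V$ is exactly represented by a circuit $D$ on $n+m$ qubits using $m$ (clean) ancillas if $D\,|\psi\rangle|0\rangle^{\otimes m}=(V|\psi\rangle)|0\rangle^{\otimes m}$ for every $n$-qubit state $|\psi\rangle$, and $V$ can be exactly represented if this holds for some $m\in\mathbb{N}$ and some such circuit $D$. A $2^n\times 2^n$ complex matrix $V$ can be exactly represented by a circuit over $\{X,CX,CCX,H,S\}$ if and only if $V$ is unitary and $V=W/\sqrt2^{\,q}$ for some matrix $W$ over $\mathbb{Z}[i]$ and some $q\in\mathbb{N}$. Moreover, a single ancilla always suffices: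 every matrix $V$ that can be exactly represented can be exactly represented using one clean ancilla. -/

import Mathlib

open scoped Matrix

noncomputable section

/-- The computational basis of `n` qubits: bit strings of length `n`, the bit `x 0` belonging
to the first tensor factor. -/
abbrev QBasis (n : ℕ) : Type := Fin n → Fin 2

/-- A `2 ^ n × 2 ^ n` complex matrix, with rows and columns labelled by the computational basis. -/
abbrev QMatrix (n : ℕ) : Type := Matrix (QBasis n) (QBasis n) ℂ

/-- A vector of the `2 ^ n`-dimensional space of `n` qubits. -/
abbrev QVec (n : ℕ) : Type := QBasis n → ℂ

/-- `ψ` is an `n`-qubit state, that is, a vector of Euclidean norm one. -/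
def IsQState {n : ℕ} (ψ : QVec n) : Prop := ∑ x, ‖ψ x‖ ^ 2 = 1

/-- The tensor product of an `n`-qubit vector and an `m`-qubit vector. -/
def tensorVec {n m : ℕ} (ψ : QVec n) (φ : QVec m) : QVec (n + m) :=
  fun x => ψ (fun i => x (Fin.castAdd m i)) * φ (fun j => x (Fin.natAdd n j))

/-- The basis state in which all `m` qubits are `0`. -/
def ketZero (m : ℕ) : QVec m := fun x => if x = 0 then 1 else 0

/-- A `2 × 2` matrix, regarded as a matrix acting on one qubit. -/
def oneQubit (M : Matrix (Fin 2) (Fin 2) ℂ) : QMatrix 1 := fun x y => M (x 0) (y 0)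

/-- The controlled version `I ⊕ U` of `U`; the new first qubit is the control. -/
def controlled {k : ℕ} (U : QMatrix k) : QMatrix (k + 1) := fun x y =>
  if x 0 = y 0 then
    if x 0 = 1 then U (Fin.tail x) (Fin.tail y) else (1 : QMatrix k) (Fin.tail x) (Fin.tail y)
  else 0

def gateX : QMatrix 1 := oneQubit !![0, 1; 1, 0]

def gateH : QMatrix 1 := oneQubit (((Real.sqrt 2 : ℝ) : ℂ)⁻¹ • !![1, 1; 1, -1])

def gateS : QMatrix 1 := oneQubit !![1, 0; 0, Complex.I]

def gateCX : QMatrix 2 := controlled gateX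

def gateCCX : QMatrix 3 := controlled gateCX

/-- A gate is a number of qubits together with a matrix acting on that many qubits. -/
abbrev QGate : Type := Σ k : ℕ, QMatrix k

/-- The gate set `{X, CX, CCX, H, S}`. -/
def gaussianGateSet : Set QGate :=
  {⟨1, gateX⟩, ⟨2, gateCX⟩, ⟨3, gateCCX⟩, ⟨1, gateH⟩, ⟨1, gateS⟩}

/-- The action on `n` qubits of `G` applied to the distinct qubits `e 0, …, e (k - 1)`, the
other qubits being left unchanged: up to the order of the tensor factors, `G ⊗ I`. -/
def applyOn {k n : ℕ} (G : QMatrix k) (e : Fin k ↪ Fin n) : QMatrix n := fun x y =>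
  open Classical in
  if ∀ j, j ∉ Set.range e → x j = y j then G (fun i => x (e i)) (fun i => y (e i)) else 0

/-- Circuits on `n` qubits over the gate set `𝒢`. -/
inductive QCircuit (𝒢 : Set QGate) (n : ℕ) : Type
  | empty : QCircuit 𝒢 n
  | gate (g : QGate) (hg : g ∈ 𝒢) (wires : Fin g.1 ↪ Fin n) : QCircuit 𝒢 n
  | comp (C D : QCircuit 𝒢 n) : QCircuit 𝒢 n

/-- The matrix of a circuit; in `comp C D` the circuit `C` is executed first. -/
def QCircuit.matrix {𝒢 : Set QGate} {n : ℕ} : QCircuit 𝒢 n → QMatrix n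
  | .empty => 1
  | .gate g _ wires => applyOn g.2 wires
  | .comp C D => D.matrix * C.matrix

/-- The circuit `D` on `n + m` qubits exactly represents the matrix `V` on the first `n` qubits,
the last `m` qubits being clean ancillas. -/
def QCircuit.Represents {𝒢 : Set QGate} {n m : ℕ} (D : QCircuit 𝒢 (n + m)) (V : QMatrix n) :
    Prop :=
  ∀ ψ : QVec n, IsQState ψ →
    D.matrix *ᵥ tensorVec ψ (ketZero m) = tensorVec (V *ᵥ ψ) (ketZero m)

/-- `V` is exactly represented by some circuit over `𝒢` using `m` clean ancillas. -/
def RepresentableWith (𝒢 : Set QGate) (m : ℕ) {n : ℕ} (V : QMatrix n) : Prop :=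
  ∃ D : QCircuit 𝒢 (n + m), D.Represents V

/-- `V` is exactly represented by some circuit over `𝒢`, with any number of clean ancillas. -/
def Representable (𝒢 : Set QGate) {n : ℕ} (V : QMatrix n) : Prop :=
  ∃ m : ℕ, RepresentableWith 𝒢 m V

end

noncomputable section

/-! ### Matrices acting on one qubit, selected by the basis state -/

open Matrix Function

/-! Necessity is soft. Every gate is unitary with entries in `ℤ[i]` up to powers of `√2`, and
products inherit both. With `J` the isometry adjoining the ancillas, representation means `D J = J
V`; hence `V` is unitary, and `V = Jᴴ D J` is a submatrix of `D`.

For sufficiency, the scalar `ω = e^(iπ/4)`, obtained from `(HS)³` on the ancilla, trades the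
denominator `√2^q` for `(1+i)^q`, since `ω √2 = 1 + i`. A unitary over `ℤ[i]` with denominator
`(1+i)^q` is then reduced column by column (`mem_of_hasLevelGenerators`). The numerators of a unit
column have norms summing to `2^q`, so for `q > 0` an even number of them are odd. Two odd entries
agree modulo 2 after multiplying one by a power of `i`, and a two-level `ωH` then makes both
divisible by `1 + i`. Once all entries are divisible, one factor cancels from the denominator. At `q
= 0` a single unit remains, which is rotated to 1 and swapped into place.

It remains to build these one- and two-level matrices with one ancilla. Commutators of controlled
flips give multiply controlled `X` gates from a single spare qubit in an arbitrary state
(`ctrlBlock_allOne_mem`). Computing a conjunction into the ancilla, applying a controlled `S` and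
uncomputing gives a phase `i` at one basis state (`phaseOn_allOne_mem`). Conjugations and `S(HSH)S =
ωH` give the two-level matrices for basis states differing in one bit, and conjugation by swaps
reaches all other pairs. -/

/-- The matrix acting on qubit `t` by a `2 × 2` matrix `U x` selected by the basis state `x`. -/
def blockOn {N : ℕ} (t : Fin N) (U : QBasis N → Matrix (Fin 2) (Fin 2) ℂ) : QMatrix N :=
  fun x y => if y = update x t (y t) then U x (x t) (y t) else 0

/-- `U` does not depend on bit `t`. -/
def IndepOf {N : ℕ} {α : Type*} (t : Fin N) (U : QBasis N → α) : Prop :=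
  ∀ x b, U (update x t b) = U x

theorem indepOf_const {N : ℕ} {α : Type*} (t : Fin N) (c : α) : IndepOf t (fun _ => c) :=
  fun _ _ => rfl

theorem IndepOf.comp {N : ℕ} {α β : Type*} {t : Fin N} {U : QBasis N → α} (hU : IndepOf t U)
    (f : α → β) : IndepOf t (fun x => f (U x)) := fun x b => congrArg f (hU x b)

theorem IndepOf.ite {N : ℕ} {α : Type*} {t : Fin N} {p : QBasis N → Prop} [DecidablePred p]
    {U V : QBasis N → α} (hp : IndepOf t p) (hU : IndepOf t U) (hV : IndepOf t V) :
    IndepOf t (fun x => if p x then U x else V x) := by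
  intro x b
  simp only [hp x b, hU x b, hV x b]

theorem indepOf_bit {N : ℕ} {t c : Fin N} (h : c ≠ t) : IndepOf t (fun x => x c = 1) := by
  intro x b
  simp [update_of_ne h]

theorem blockOn_mul_apply {N : ℕ} (t : Fin N) (U : QBasis N → Matrix (Fin 2) (Fin 2) ℂ)
    (M : QMatrix N) (x y : QBasis N) :
    (blockOn t U * M) x y = ∑ b, U x (x t) b * M (update x t b) y := by
  rw [Matrix.mul_apply]
  symm
  refine Finset.sum_of_injOn (fun b => update x t b) ?_ ?_ ?_ ?_
  · intro a _ b _ h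
    simpa using congrFun h t
  · simp
  · intro z _ hz
    have : z ≠ update x t (z t) := fun h => hz ⟨z t, by simp, h.symm⟩
    simp [blockOn, this]
  · intro b _
    simp [blockOn]

/-- The first factor changes only bit `t`, so `V` still selects the same block afterwards. This is
why independence is demanded of `V` alone. -/
theorem blockOn_mul {N : ℕ} {t : Fin N} {U V : QBasis N → Matrix (Fin 2) (Fin 2) ℂ}
    (hV : IndepOf t V) : blockOn t U * blockOn t V = blockOn t (fun x => U x * V x) := by
  ext x y
  rw [blockOn_mul_apply]
  simp only [blockOn, update_idem, update_self, hV x]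
  split_ifs <;> simp [Matrix.mul_apply]

theorem blockOn_diagonal {N : ℕ} (t : Fin N) (d : QBasis N → Fin 2 → ℂ) :
    blockOn t (fun x => diagonal (d x)) = diagonal (fun x => d x (x t)) := by
  ext x y
  simp only [blockOn, diagonal_apply]
  by_cases h : x = y
  · subst h; simp
  · by_cases h' : y = update x t (y t)
    · have : x t ≠ y t := fun e => h (by rw [h', ← e, update_eq_self])
      simp [h, this]
    · simp [h, h']

theorem blockOn_smul_one {N : ℕ} (t : Fin N) (d : QBasis N → ℂ) :
    blockOn t (fun x => d x • 1) = diagonal d := by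
  rw [← blockOn_diagonal t (fun x _ => d x)]
  simp only [smul_one_eq_diagonal]

theorem blockOn_one {N : ℕ} (t : Fin N) : blockOn t (fun _ => 1) = 1 := by
  simpa using blockOn_smul_one t (fun _ => 1)

theorem blockOn_conjTranspose {N : ℕ} {t : Fin N} {U : QBasis N → Matrix (Fin 2) (Fin 2) ℂ}
    (hU : IndepOf t U) : (blockOn t U)ᴴ = blockOn t (fun x => (U x)ᴴ) := by
  ext x y
  have key : x = update y t (x t) ↔ y = update x t (y t) := by
    constructor <;> intro h <;> rw [h] <;> simp
  simp only [conjTranspose_apply, blockOn, key]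
  split_ifs with h
  · rw [h, hU]
  · simp

theorem blockOn_mem_unitary {N : ℕ} {t : Fin N} {U : QBasis N → Matrix (Fin 2) (Fin 2) ℂ}
    (hU : IndepOf t U) (h : ∀ x, U x ∈ unitaryGroup (Fin 2) ℂ) :
    blockOn t U ∈ unitaryGroup (QBasis N) ℂ := by
  rw [mem_unitaryGroup_iff, star_eq_conjTranspose, blockOn_conjTranspose hU,
    blockOn_mul (hU.comp conjTranspose), ← blockOn_one t]
  congr 1
  ext x : 1
  exact mem_unitaryGroup_iff.1 (h x)

/-! ### Gates as block matrices -/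

theorem applyOn_oneQubit {N : ℕ} (M : Matrix (Fin 2) (Fin 2) ℂ) (e : Fin 1 ↪ Fin N) :
    applyOn (oneQubit M) e = blockOn (e 0) (fun _ => M) := by
  classical
  ext x y
  simp only [applyOn, blockOn, oneQubit]
  have : (∀ j, j ∉ Set.range e → x j = y j) ↔ y = update x (e 0) (y (e 0)) := by
    constructor
    · intro h
      ext j : 1
      by_cases hj : j = e 0
      · subst hj; simp
      · rw [update_of_ne hj, h j]
        rintro ⟨i, rfl⟩
        exact hj (by rw [Subsingleton.elim i 0])
    · intro h j hj
      rw [h, update_of_ne]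
      rintro rfl
      exact hj ⟨0, rfl⟩
  simp only [this]

theorem applyOn_controlled {k N : ℕ} (G : QMatrix k) (e : Fin (k + 1) ↪ Fin N) :
    applyOn (controlled G) e = fun x y =>
      if x (e 0) = 1 then applyOn G ((Fin.succEmb k).trans e) x y else (1 : QMatrix N) x y := by
  classical
  ext x y
  have hr : ∀ j, j ∉ Set.range ((Fin.succEmb k).trans e) ↔ j ∉ Set.range e ∨ j = e 0 := by
    intro j
    constructor
    · intro h
      by_cases hj : j ∈ Set.range e
      · obtain ⟨i, rfl⟩ := hj
        right
        rcases Fin.eq_zero_or_eq_succ i with rfl | ⟨i, rfl⟩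
        · rfl
        · exact absurd ⟨i, rfl⟩ h
      · exact Or.inl hj
    · rintro (h | rfl) ⟨i, hi⟩
      · exact h ⟨i.succ, hi⟩
      · exact Fin.succ_ne_zero i (e.injective hi)
  -- Dropping the control wire from the embedding adds exactly one agreement condition, at the
  -- control itself.
  have hiff : (∀ j, j ∉ Set.range ((Fin.succEmb k).trans e) → x j = y j) ↔
      (∀ j, j ∉ Set.range e → x j = y j) ∧ x (e 0) = y (e 0) := by
    simp only [hr, or_imp, forall_and, forall_eq]
  have h1 : x = y ↔ ((∀ j, j ∉ Set.range e → x j = y j) ∧ x (e 0) = y (e 0)) ∧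
      (Fin.tail fun i => x (e i)) = Fin.tail fun i => y (e i) := by
    constructor
    · rintro rfl; simp
    · rintro ⟨⟨h, h0⟩, ht⟩
      ext j : 1
      by_cases hj : j ∈ Set.range e
      · obtain ⟨i, rfl⟩ := hj
        rcases Fin.eq_zero_or_eq_succ i with rfl | ⟨i, rfl⟩
        · exact h0
        · exact congrFun ht i
      · exact h j hj
  simp only [applyOn, controlled, hiff, Matrix.one_apply, h1]
  clear h1 hiff hr
  split_ifs <;> first | rfl | (exfalso; tauto)

theorem blockOn_control {N : ℕ} {t c : Fin N} (U : QBasis N → Matrix (Fin 2) (Fin 2) ℂ) :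
    (fun x y => if x c = 1 then blockOn t U x y else (1 : QMatrix N) x y) =
      blockOn t (fun x => if x c = 1 then U x else 1) := by
  ext x y
  rw [← blockOn_one t]
  simp only [blockOn]
  split_ifs <;> rfl

/-- The Pauli matrix `X`. -/
def pauliX : Matrix (Fin 2) (Fin 2) ℂ := !![0, 1; 1, 0]

/-- The Hadamard matrix. -/
def hadamardH : Matrix (Fin 2) (Fin 2) ℂ := ((Real.sqrt 2 : ℝ) : ℂ)⁻¹ • !![1, 1; 1, -1]

/-- The phase matrix. -/
def phaseS : Matrix (Fin 2) (Fin 2) ℂ := !![1, 0; 0, Complex.I]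

theorem applyOn_gateX {N : ℕ} (e : Fin 1 ↪ Fin N) :
    applyOn gateX e = blockOn (e 0) (fun _ => pauliX) := applyOn_oneQubit _ e

theorem applyOn_gateH {N : ℕ} (e : Fin 1 ↪ Fin N) :
    applyOn gateH e = blockOn (e 0) (fun _ => hadamardH) := applyOn_oneQubit _ e

theorem applyOn_gateS {N : ℕ} (e : Fin 1 ↪ Fin N) :
    applyOn gateS e = blockOn (e 0) (fun _ => phaseS) := applyOn_oneQubit _ e

theorem applyOn_gateCX {N : ℕ} (e : Fin 2 ↪ Fin N) :
    applyOn gateCX e = blockOn (e 1) (fun x => if x (e 0) = 1 then pauliX else 1) := by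
  rw [gateCX, applyOn_controlled, applyOn_gateX, blockOn_control]
  rfl

theorem applyOn_gateCCX {N : ℕ} (e : Fin 3 ↪ Fin N) :
    applyOn gateCCX e = blockOn (e 2)
      (fun x => if x (e 0) = 1 then if x (e 1) = 1 then pauliX else 1 else 1) := by
  rw [gateCCX, applyOn_controlled, applyOn_gateCX, blockOn_control]
  rfl

theorem ofReal_sqrt_two_sq : ((Real.sqrt 2 : ℝ) : ℂ) * ((Real.sqrt 2 : ℝ) : ℂ) = 2 := by
  rw [← Complex.ofReal_mul, Real.mul_self_sqrt (by norm_num)]; norm_num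

theorem ofReal_sqrt_two_inv_sq :
    ((Real.sqrt 2 : ℝ) : ℂ)⁻¹ * ((Real.sqrt 2 : ℝ) : ℂ)⁻¹ = 2⁻¹ := by
  rw [← mul_inv, ofReal_sqrt_two_sq]

/-! ### Unitarity of gates and circuits -/

theorem pauliX_mem_unitary : pauliX ∈ unitaryGroup (Fin 2) ℂ := by
  rw [mem_unitaryGroup_iff]
  ext i j
  fin_cases i <;> fin_cases j <;> simp [pauliX, Matrix.mul_apply, Fin.sum_univ_two]

theorem phaseS_mem_unitary : phaseS ∈ unitaryGroup (Fin 2) ℂ := by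
  rw [mem_unitaryGroup_iff]
  ext i j
  fin_cases i <;> fin_cases j <;> simp [phaseS, Matrix.mul_apply, Fin.sum_univ_two]

theorem hadamard_mem_unitary : hadamardH ∈ unitaryGroup (Fin 2) ℂ := by
  rw [mem_unitaryGroup_iff]
  ext i j
  fin_cases i <;> fin_cases j <;>
    simp [hadamardH, Matrix.mul_apply, Fin.sum_univ_two, ← mul_inv, ofReal_sqrt_two_sq] <;> norm_num

theorem gate_mem_unitary {N : ℕ} {g : QGate} (hg : g ∈ gaussianGateSet) (e : Fin g.1 ↪ Fin N) :
    applyOn g.2 e ∈ unitaryGroup (QBasis N) ℂ := by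
  rcases hg with rfl | rfl | rfl | rfl | rfl
  · rw [applyOn_gateX]
    exact blockOn_mem_unitary (indepOf_const _ _) fun _ => pauliX_mem_unitary
  · rw [applyOn_gateCX]
    refine blockOn_mem_unitary ((indepOf_bit ?_).ite (indepOf_const _ _) (indepOf_const _ _))
      fun x => ?_
    · exact e.injective.ne (by decide)
    · split_ifs
      · exact pauliX_mem_unitary
      · exact one_mem _
  · rw [applyOn_gateCCX]
    refine blockOn_mem_unitary ((indepOf_bit ?_).ite ((indepOf_bit ?_).ite (indepOf_const _ _)
      (indepOf_const _ _)) (indepOf_const _ _)) fun x => ?_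
    · exact e.injective.ne (by decide)
    · exact e.injective.ne (by decide)
    · split_ifs
      · exact pauliX_mem_unitary
      · exact one_mem _
      · exact one_mem _
  · rw [applyOn_gateH]
    exact blockOn_mem_unitary (indepOf_const _ _) fun _ => hadamard_mem_unitary
  · rw [applyOn_gateS]
    exact blockOn_mem_unitary (indepOf_const _ _) fun _ => phaseS_mem_unitary

theorem QCircuit.matrix_mem_unitary {N : ℕ} (D : QCircuit gaussianGateSet N) :
    D.matrix ∈ unitaryGroup (QBasis N) ℂ := by
  induction D with
  | empty => exact one_mem _
  | gate g hg e => exact gate_mem_unitary hg e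
  | comp C D hC hD => exact mul_mem hD hC

/-! ### Matrices over the Gaussian integers up to a denominator -/

/-- The square matrices of the form `W / c ^ q` with `W` over the Gaussian integers. -/
def gaussianForm (ι : Type*) [Fintype ι] [DecidableEq ι] (c : ℂ) : Submonoid (Matrix ι ι ℂ) where
  carrier := {V | ∃ (q : ℕ) (W : Matrix ι ι GaussianInt),
    V = (c ^ q)⁻¹ • W.map GaussianInt.toComplex}
  one_mem' := ⟨0, 1, by ext i j; by_cases h : i = j <;> simp [Matrix.one_apply, h]⟩
  mul_mem' := by
    rintro _ _ ⟨q, W, rfl⟩ ⟨r, Z, rfl⟩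
    refine ⟨q + r, W * Z, ?_⟩
    rw [Matrix.map_mul, Matrix.smul_mul, Matrix.mul_smul, smul_smul, pow_add, mul_inv]

theorem oneQubit_mem_gaussianForm {M : Matrix (Fin 2) (Fin 2) ℂ} {c : ℂ}
    (hM : M ∈ gaussianForm (Fin 2) c) : oneQubit M ∈ gaussianForm (QBasis 1) c := by
  obtain ⟨q, W, rfl⟩ := hM
  exact ⟨q, W.submatrix (fun x => x 0) (fun x => x 0), rfl⟩

theorem controlled_mem_gaussianForm {k : ℕ} {U : QMatrix k}
    (hU : ∃ W : Matrix (QBasis k) (QBasis k) GaussianInt, U = W.map GaussianInt.toComplex) :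
    ∃ W : Matrix (QBasis (k + 1)) (QBasis (k + 1)) GaussianInt,
      controlled U = W.map GaussianInt.toComplex := by
  obtain ⟨W, rfl⟩ := hU
  refine ⟨of fun x y => if x 0 = y 0 then if x 0 = 1 then W (Fin.tail x) (Fin.tail y) else
    (1 : Matrix (QBasis k) (QBasis k) GaussianInt) (Fin.tail x) (Fin.tail y) else 0, ?_⟩
  ext x y
  simp only [controlled, Matrix.map_apply, Matrix.one_apply, of_apply]
  split_ifs <;> simp

theorem gate_mem_gaussianForm {g : QGate} (hg : g ∈ gaussianGateSet) :
    g.2 ∈ gaussianForm (QBasis g.1) ((Real.sqrt 2 : ℝ) : ℂ) := by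
  have hX : ∃ W : Matrix (QBasis 1) (QBasis 1) GaussianInt,
      gateX = W.map GaussianInt.toComplex := by
    refine ⟨(!![0, 1; 1, 0] : Matrix (Fin 2) (Fin 2) GaussianInt).submatrix
      (fun x => x 0) (fun x => x 0), ?_⟩
    ext x y
    simp only [gateX, oneQubit, Matrix.map_apply, submatrix_apply]
    generalize x 0 = a
    generalize y 0 = b
    fin_cases a <;> fin_cases b <;> simp
  have key : ∀ {k : ℕ} {U : QMatrix k}, (∃ W : Matrix (QBasis k) (QBasis k) GaussianInt,
      U = W.map GaussianInt.toComplex) → U ∈ gaussianForm (QBasis k) ((Real.sqrt 2 : ℝ) : ℂ) :=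
    fun ⟨W, h⟩ => ⟨0, W, by rw [pow_zero, inv_one, one_smul, h]⟩
  rcases hg with rfl | rfl | rfl | rfl | rfl
  · exact key hX
  · exact key (controlled_mem_gaussianForm hX)
  · exact key (controlled_mem_gaussianForm (controlled_mem_gaussianForm hX))
  · change oneQubit hadamardH ∈ gaussianForm (QBasis 1) _
    refine oneQubit_mem_gaussianForm ⟨1, !![1, 1; 1, -1], ?_⟩
    ext a b
    fin_cases a <;> fin_cases b <;> simp [hadamardH]
  · change oneQubit phaseS ∈ gaussianForm (QBasis 1) _
    refine oneQubit_mem_gaussianForm ⟨0, !![1, 0; 0, ⟨0, 1⟩], ?_⟩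
    ext a b
    fin_cases a <;> fin_cases b <;> simp [phaseS, GaussianInt.toComplex_def]

theorem applyOn_mem_gaussianForm {k N : ℕ} {G : QMatrix k} {c : ℂ}
    (hG : G ∈ gaussianForm (QBasis k) c) (e : Fin k ↪ Fin N) :
    applyOn G e ∈ gaussianForm (QBasis N) c := by
  classical
  obtain ⟨q, W, rfl⟩ := hG
  refine ⟨q, of fun x y => if ∀ j, j ∉ Set.range e → x j = y j then
    W (fun i => x (e i)) (fun i => y (e i)) else 0, ?_⟩
  ext x y
  simp only [applyOn, Matrix.smul_apply, Matrix.map_apply, of_apply]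
  split_ifs <;> simp

theorem QCircuit.matrix_mem_gaussianForm {N : ℕ} (D : QCircuit gaussianGateSet N) :
    D.matrix ∈ gaussianForm (QBasis N) ((Real.sqrt 2 : ℝ) : ℂ) := by
  induction D with
  | empty => exact one_mem _
  | gate g hg e => exact applyOn_mem_gaussianForm (gate_mem_gaussianForm hg) e
  | comp C D hC hD => exact mul_mem hD hC

/-! ### Representation in terms of the ancilla embedding -/

/-- The matrix of the embedding `|x⟩ ↦ |x⟩|0⟩`. -/
def ancillaEmb (n m : ℕ) : Matrix (QBasis (n + m)) (QBasis n) ℂ :=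
  fun w x => if w = Fin.append x 0 then 1 else 0

theorem tensorVec_ketZero {n m : ℕ} (ψ : QVec n) :
    tensorVec ψ (ketZero m) = ancillaEmb n m *ᵥ ψ := by
  ext w
  simp only [tensorVec, ketZero, ancillaEmb, mulVec, dotProduct]
  have hw : ∀ x : QBasis n, w = Fin.append x 0 ↔
      x = (fun i => w (Fin.castAdd m i)) ∧ (fun j => w (Fin.natAdd n j)) = 0 := by
    intro x
    constructor
    · rintro rfl
      constructor <;> ext <;> simp
    · rintro ⟨rfl, h⟩
      ext j : 1
      refine Fin.addCases (fun i => ?_) (fun i => ?_) j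
      · simp
      · rw [Fin.append_right]; exact congrFun h i
  simp only [hw]
  by_cases h : (fun j => w (Fin.natAdd n j)) = 0 <;> simp [h]

theorem ancillaEmb_conjTranspose_mul (n m : ℕ) : (ancillaEmb n m)ᴴ * ancillaEmb n m = 1 := by
  ext x y
  have : ∀ x y : QBasis n, (Fin.append x 0 : QBasis (n + m)) = Fin.append y 0 ↔ x = y := by
    intro x y
    constructor
    · intro h
      ext i : 1
      simpa using congrFun h (Fin.castAdd m i)
    · rintro rfl; rfl
  simp [Matrix.mul_apply, ancillaEmb, Matrix.one_apply, this, eq_comm]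

/-- Basis vectors are states, so testing on states already determines every column. -/
theorem QCircuit.represents_iff {𝒢 : Set QGate} {n m : ℕ} (D : QCircuit 𝒢 (n + m)) (V : QMatrix n) :
    D.Represents V ↔ D.matrix * ancillaEmb n m = ancillaEmb n m * V := by
  simp only [QCircuit.Represents, tensorVec_ketZero, mulVec_mulVec]
  constructor
  · intro h
    ext i x
    have hx : IsQState (Pi.single x (1 : ℂ) : QVec n) := by
      rw [IsQState, Finset.sum_eq_single x] <;> simp +contextual
    simpa using congrFun (h _ hx) i
  · intro h ψ _
    rw [h]

/-- From `D J = J V` with `JᴴJ = 1` and `DᴴD = 1` one gets `VᴴV = 1`, while `V = Jᴴ D J` selects the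
entries of `D` whose ancilla bits are zero. -/
theorem isUnitary_and_gaussianForm_of_representable {n : ℕ} {V : QMatrix n}
    (h : Representable gaussianGateSet V) :
    V ∈ unitaryGroup (QBasis n) ℂ ∧ V ∈ gaussianForm (QBasis n) ((Real.sqrt 2 : ℝ) : ℂ) := by
  obtain ⟨m, D, hD⟩ := h
  rw [QCircuit.represents_iff] at hD
  have hJ := ancillaEmb_conjTranspose_mul n m
  constructor
  · have hu := mem_unitaryGroup_iff'.1 D.matrix_mem_unitary
    rw [star_eq_conjTranspose] at hu
    rw [mem_unitaryGroup_iff', star_eq_conjTranspose]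
    calc Vᴴ * V = (ancillaEmb n m * V)ᴴ * (ancillaEmb n m * V) := by
          rw [conjTranspose_mul, Matrix.mul_assoc, ← Matrix.mul_assoc _ _ V, hJ, Matrix.one_mul]
      _ = 1 := by
          rw [← hD, conjTranspose_mul, Matrix.mul_assoc, ← Matrix.mul_assoc _ D.matrix, hu,
            Matrix.one_mul, hJ]
  · obtain ⟨q, W, hW⟩ := D.matrix_mem_gaussianForm
    refine ⟨q, W.submatrix (fun x => Fin.append x 0) (fun x => Fin.append x 0), ?_⟩
    have hV : V = (ancillaEmb n m)ᴴ * (D.matrix * ancillaEmb n m) := by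
      rw [hD, ← Matrix.mul_assoc, hJ, Matrix.one_mul]
    rw [hV, hW]
    ext x y
    simp [Matrix.mul_apply, ancillaEmb]

/-! ### Controlled operations and functions of basis states -/

open Classical in
/-- The matrix `U` applied to qubit `t` on the basis states satisfying `p`. -/
def ctrlBlock {N : ℕ} (t : Fin N) (p : QBasis N → Prop) (U : Matrix (Fin 2) (Fin 2) ℂ) :
    QMatrix N := blockOn t (fun x => if p x then U else 1)

theorem ctrlBlock_true {N : ℕ} (t : Fin N) (U : Matrix (Fin 2) (Fin 2) ℂ) :
    ctrlBlock t (fun _ => True) U = blockOn t (fun _ => U) := by simp [ctrlBlock]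

theorem ctrlBlock_mul {N : ℕ} {t : Fin N} {p : QBasis N → Prop} (hp : IndepOf t p)
    (U V : Matrix (Fin 2) (Fin 2) ℂ) :
    ctrlBlock t p U * ctrlBlock t p V = ctrlBlock t p (U * V) := by
  classical
  rw [ctrlBlock, ctrlBlock, blockOn_mul (hp.ite (indepOf_const _ _) (indepOf_const _ _)), ctrlBlock]
  congr 1
  ext x : 1
  split_ifs <;> simp

theorem blockOn_mul_ctrlBlock_mul {N : ℕ} {t : Fin N} {p : QBasis N → Prop} (hp : IndepOf t p)
    {A B : Matrix (Fin 2) (Fin 2) ℂ} (hAB : A * B = 1) (U : Matrix (Fin 2) (Fin 2) ℂ) :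
    blockOn t (fun _ => A) * ctrlBlock t p U * blockOn t (fun _ => B) =
      ctrlBlock t p (A * U * B) := by
  classical
  rw [ctrlBlock, blockOn_mul (hp.ite (indepOf_const _ _) (indepOf_const _ _)),
    blockOn_mul (indepOf_const _ _), ctrlBlock]
  congr 1
  ext x : 1
  split_ifs <;> simp [hAB]

open Classical in
/-- The diagonal matrix with entry `i` at the basis states satisfying `p` and `1` elsewhere. -/
def phaseOn {N : ℕ} (p : QBasis N → Prop) : QMatrix N :=
  diagonal (fun x => if p x then Complex.I else 1)

/-- A controlled scalar does not touch its target: the phase is kicked back onto the controls. Hence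
a spare qubit can serve as target. -/
theorem ctrlBlock_I_smul_one {N : ℕ} (t : Fin N) (p : QBasis N → Prop) :
    ctrlBlock t p (Complex.I • 1) = phaseOn p := by
  classical
  rw [phaseOn, ← blockOn_smul_one t, ctrlBlock]
  congr 1
  ext x : 1
  split_ifs <;> simp

theorem phaseS_eq_diagonal : phaseS = diagonal (fun b => if b = 1 then Complex.I else 1) := by
  ext a b
  fin_cases a <;> fin_cases b <;> simp [phaseS]

theorem ctrlBlock_phaseS {N : ℕ} (t : Fin N) (p : QBasis N → Prop) :
    ctrlBlock t p phaseS = phaseOn (fun x => p x ∧ x t = 1) := by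
  classical
  have : ∀ x, (if p x then phaseS else 1) =
      diagonal (fun b => if p x ∧ b = 1 then Complex.I else 1) := by
    intro x
    by_cases h : p x <;> simp [h, phaseS_eq_diagonal]
  simp only [ctrlBlock, this, phaseOn]
  rw [blockOn_diagonal t fun x b => if p x ∧ b = 1 then Complex.I else 1]
  congr 1
  ext x
  congr

/-- The matrix sending a row vector at `x` to a row vector at `f x`. -/
def funMatrix {N : ℕ} (f : QBasis N → QBasis N) : QMatrix N := fun x y => if y = f x then 1 else 0

theorem funMatrix_mul_apply {N : ℕ} (f : QBasis N → QBasis N) (M : QMatrix N) (x y : QBasis N) :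
    (funMatrix f * M) x y = M (f x) y := by
  simp [Matrix.mul_apply, funMatrix]

theorem funMatrix_mul {N : ℕ} (f g : QBasis N → QBasis N) :
    funMatrix f * funMatrix g = funMatrix (g ∘ f) := by
  ext x y
  rw [funMatrix_mul_apply]
  rfl

theorem funMatrix_mul_diagonal_mul {N : ℕ} {f : QBasis N → QBasis N} (hf : Involutive f)
    (d : QBasis N → ℂ) : funMatrix f * diagonal d * funMatrix f = diagonal (d ∘ f) := by
  ext x y
  rw [Matrix.mul_assoc, funMatrix_mul_apply, diagonal_mul, diagonal_apply]
  by_cases h : x = y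
  · subst h; simp [funMatrix, hf x]
  · simp [funMatrix, hf x, h, Ne.symm h]

theorem funMatrix_mul_phaseOn_mul {N : ℕ} {f : QBasis N → QBasis N} (hf : Involutive f)
    (p : QBasis N → Prop) :
    funMatrix f * phaseOn p * funMatrix f = phaseOn (fun x => p (f x)) :=
  funMatrix_mul_diagonal_mul hf _

open Classical in
/-- Flip bit `t` of the basis states satisfying `p`. -/
def ctrlFlip {N : ℕ} (t : Fin N) (p : QBasis N → Prop) (x : QBasis N) : QBasis N :=
  if p x then update x t (x t + 1) else x

theorem ctrlFlip_apply_of_ne {N : ℕ} {t j : Fin N} (h : j ≠ t) (p : QBasis N → Prop)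
    (x : QBasis N) : ctrlFlip t p x j = x j := by
  unfold ctrlFlip
  split_ifs <;> simp [h]

theorem Fin.two_add_one_add_one (b : Fin 2) : b + 1 + 1 = b := by fin_cases b <;> rfl

theorem ctrlFlip_involutive {N : ℕ} {t : Fin N} {p : QBasis N → Prop} (hp : IndepOf t p) :
    Involutive (ctrlFlip t p) := by
  intro x
  by_cases h : p x
  · simp [ctrlFlip, h, hp x, Fin.two_add_one_add_one]
  · simp [ctrlFlip, h]

theorem ctrlBlock_pauliX {N : ℕ} (t : Fin N) (p : QBasis N → Prop) :
    ctrlBlock t p pauliX = funMatrix (ctrlFlip t p) := by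
  classical
  have key : ∀ a b : Fin 2, pauliX a b = if b = a + 1 then 1 else 0 := by
    intro a b
    fin_cases a <;> fin_cases b <;> simp [pauliX]
  ext x y
  simp only [ctrlBlock, blockOn, funMatrix, ctrlFlip]
  by_cases h : p x
  · simp only [h, if_true, key]
    by_cases hy : y = update x t (x t + 1)
    · rw [if_pos (by rw [hy]; simp), if_pos (by rw [hy]; simp), if_pos hy]
    · rw [if_neg hy]
      split_ifs with h1 h2
      · exact absurd (h2 ▸ h1) hy
      · rfl
      · rfl
  · simp only [h, if_false]
    have := congrFun (congrFun (blockOn_one t) x) y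
    simp only [blockOn] at this
    rw [this, Matrix.one_apply]
    simp only [eq_comm]

/-- The commutator of two controlled flips is a flip with more controls. -/
theorem ctrlFlip_commutator {N : ℕ} {d t : Fin N} (hdt : d ≠ t) {p q : QBasis N → Prop}
    (hpd : IndepOf d p) (hpt : IndepOf t p) (hqd : IndepOf d q) (hqt : IndepOf t q) :
    ctrlFlip d p ∘ ctrlFlip t (fun x => q x ∧ x d = 1) ∘ ctrlFlip d p ∘
      ctrlFlip t (fun x => q x ∧ x d = 1) = ctrlFlip t (fun x => p x ∧ q x) := by
  ext x : 1
  have h2 : ∀ b : Fin 2, b = 0 ∨ b = 1 := by decide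
  have hx : update x d (x d) = x := update_eq_self _ _
  by_cases hp : p x <;> by_cases hq : q x <;> rcases h2 (x d) with hd | hd <;> rw [hd] at hx <;>
    simp [ctrlFlip, hp, hq, hd, hpd _, hpt _, hqd _, hqt _, hdt, hdt.symm,
      update_comm hdt, hx, Fin.two_add_one_add_one]

/-! ### Circuits -/

/-- The monoid of matrices of circuits on `N` qubits. -/
def circuitMonoid (N : ℕ) : Submonoid (QMatrix N) where
  carrier := {M | ∃ D : QCircuit gaussianGateSet N, D.matrix = M}
  one_mem' := ⟨.empty, rfl⟩
  mul_mem' := by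
    rintro _ _ ⟨C, rfl⟩ ⟨D, rfl⟩
    exact ⟨.comp D C, rfl⟩

theorem applyOn_mem_circuitMonoid {N : ℕ} {g : QGate} (hg : g ∈ gaussianGateSet)
    (e : Fin g.1 ↪ Fin N) : applyOn g.2 e ∈ circuitMonoid N := ⟨.gate g hg e, rfl⟩

/-- A single wire. -/
def wireEmb {N : ℕ} (t : Fin N) : Fin 1 ↪ Fin N := ⟨fun _ => t, fun _ _ _ => Subsingleton.elim _ _⟩

theorem pauliX_mem_circuitMonoid {N : ℕ} (t : Fin N) :
    blockOn t (fun _ => pauliX) ∈ circuitMonoid N := by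
  have := applyOn_mem_circuitMonoid (g := ⟨1, gateX⟩) (by simp [gaussianGateSet]) (wireEmb t)
  rwa [applyOn_gateX] at this

theorem hadamard_mem_circuitMonoid {N : ℕ} (t : Fin N) :
    blockOn t (fun _ => hadamardH) ∈ circuitMonoid N := by
  have := applyOn_mem_circuitMonoid (g := ⟨1, gateH⟩) (by simp [gaussianGateSet]) (wireEmb t)
  rwa [applyOn_gateH] at this

theorem phaseS_mem_circuitMonoid {N : ℕ} (t : Fin N) :
    blockOn t (fun _ => phaseS) ∈ circuitMonoid N := by
  have := applyOn_mem_circuitMonoid (g := ⟨1, gateS⟩) (by simp [gaussianGateSet]) (wireEmb t)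
  rwa [applyOn_gateS] at this

theorem ctrlBlock_one_mem {N : ℕ} {a t : Fin N} (h : a ≠ t) :
    ctrlBlock t (fun x => x a = 1) pauliX ∈ circuitMonoid N := by
  have := applyOn_mem_circuitMonoid (N := N) (g := ⟨2, gateCX⟩) (by simp [gaussianGateSet])
    ⟨![a, t], by
      intro i j
      fin_cases i <;> fin_cases j <;> simp [h, h.symm]⟩
  rw [applyOn_gateCX] at this
  change blockOn t (fun x => if x a = 1 then pauliX else 1) ∈ circuitMonoid N at this
  convert this using 1
  unfold ctrlBlock
  congr 1
  ext x : 1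
  congr

theorem ctrlBlock_two_mem {N : ℕ} {a b t : Fin N} (hab : a ≠ b) (ha : a ≠ t) (hb : b ≠ t) :
    ctrlBlock t (fun x => x a = 1 ∧ x b = 1) pauliX ∈ circuitMonoid N := by
  have := applyOn_mem_circuitMonoid (N := N) (g := ⟨3, gateCCX⟩) (by simp [gaussianGateSet])
    ⟨![a, b, t], by
      intro i j
      fin_cases i <;> fin_cases j <;> simp [hab, hab.symm, ha, ha.symm, hb, hb.symm]⟩
  rw [applyOn_gateCCX] at this
  change blockOn t (fun x => if x a = 1 then if x b = 1 then pauliX else 1 else 1) ∈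
    circuitMonoid N at this
  convert this using 1
  unfold ctrlBlock
  congr 1
  ext x : 1
  by_cases h1 : x a = 1 <;> by_cases h2 : x b = 1 <;> simp [h1, h2]

/-- All bits in `A` are one. -/
def AllOne {N : ℕ} (A : Finset (Fin N)) (x : QBasis N) : Prop := ∀ a ∈ A, x a = 1

theorem indepOf_allOne {N : ℕ} {A : Finset (Fin N)} {t : Fin N} (h : t ∉ A) :
    IndepOf t (AllOne A) := by
  intro x b
  simp only [AllOne, eq_iff_iff]
  refine forall₂_congr fun a ha => ?_
  rw [update_of_ne]
  rintro rfl
  exact h ha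

/-- A multiply controlled flip is a circuit as soon as there is one spare qubit. -/
theorem ctrlBlock_allOne_mem {N : ℕ} (A : Finset (Fin N)) (t d : Fin N) (ht : t ∉ A) (hd : d ∉ A)
    (hdt : d ≠ t) : ctrlBlock t (AllOne A) pauliX ∈ circuitMonoid N := by
  induction hk : A.card using Nat.strong_induction_on generalizing A t d with
  | _ k ih =>
  rcases Nat.lt_or_ge k 3 with h3 | h3
  · interval_cases k
    · obtain rfl := Finset.card_eq_zero.1 hk
      have : AllOne (∅ : Finset (Fin N)) = fun _ => True := by
        ext
        simp [AllOne]
      rw [this, ctrlBlock_true]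
      exact pauliX_mem_circuitMonoid t
    · obtain ⟨a, rfl⟩ := Finset.card_eq_one.1 hk
      convert ctrlBlock_one_mem (a := a) (t := t) (by simpa [eq_comm] using ht) using 2
      ext x
      simp [AllOne]
    · obtain ⟨a, b, hab, rfl⟩ := Finset.card_eq_two.1 hk
      simp only [Finset.mem_insert, Finset.mem_singleton, not_or] at ht
      convert ctrlBlock_two_mem hab (Ne.symm ht.1) (Ne.symm ht.2) using 2
      ext x
      simp [AllOne]
  -- Two controls `C` toggle the spare qubit `d`, and `d` together with the other `k - 2` controls
  -- toggles `t`. In the commutator the unknown initial value of `d` cancels and `d` is restored.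
  -- The gate with `k - 1` controls finds its own spare qubit `c` in `C`, while the gate on `d` uses
  -- `t`.
  · obtain ⟨C, hCA, hC⟩ := Finset.exists_subset_card_eq (s := A) (n := 2) (by omega)
    have hB : (A \ C).card = k - 2 := by rw [Finset.card_sdiff_of_subset hCA]; omega
    obtain ⟨b, hb⟩ : (A \ C).Nonempty := Finset.card_pos.1 (by omega)
    obtain ⟨c, hc⟩ : C.Nonempty := Finset.card_pos.1 (by omega)
    have hb' := Finset.mem_sdiff.1 hb
    have h1 : ctrlBlock d (AllOne C) pauliX ∈ circuitMonoid N :=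
      ih 2 (by omega) C d t (fun h => hd (hCA h)) (fun h => ht (hCA h)) hdt.symm hC
    have h2 : ctrlBlock t (AllOne (insert d (A \ C))) pauliX ∈ circuitMonoid N := by
      refine ih (k - 1) (by omega) _ t c ?_ ?_ ?_ ?_
      · simp [hdt.symm, ht]
      · simp only [Finset.mem_insert, Finset.mem_sdiff, hc, not_true, and_false, or_false]
        rintro rfl
        exact hd (hCA hc)
      · rintro rfl
        exact ht (hCA hc)
      · rw [Finset.card_insert_of_notMem (by simp [hd]), hB]
        omega
    have h := mul_mem (mul_mem (mul_mem h2 h1) h2) h1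
    simp only [ctrlBlock_pauliX, funMatrix_mul] at h ⊢
    have e1 : AllOne (insert d (A \ C)) = fun x => AllOne (A \ C) x ∧ x d = 1 := by
      ext x
      simp [AllOne, and_comm]
    have e2 : AllOne A = fun x => AllOne C x ∧ AllOne (A \ C) x := by
      ext x
      simp only [AllOne, ← Finset.forall_mem_union, Finset.union_sdiff_of_subset hCA]
    rw [e1] at h
    rw [e2, ← ctrlFlip_commutator hdt (indepOf_allOne fun h => hd (hCA h))
      (indepOf_allOne fun h => ht (hCA h)) (indepOf_allOne (by simp [hd]))
      (indepOf_allOne (by simp [ht]))]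
    exact h

/-! ### The controlled phase gate -/

theorem hadamard_mul_self : hadamardH * hadamardH = 1 := by
  ext i j
  fin_cases i <;> fin_cases j <;>
    simp [hadamardH, Matrix.mul_apply, Fin.sum_univ_two, ofReal_sqrt_two_inv_sq] <;> norm_num

theorem hadamard_mul_pauliX_mul : hadamardH * pauliX * hadamardH = phaseS ^ 2 := by
  ext i j
  fin_cases i <;> fin_cases j <;>
    simp [hadamardH, pauliX, phaseS, pow_two, Matrix.mul_apply, Fin.sum_univ_two,
      ofReal_sqrt_two_inv_sq] <;> norm_num

/-- Here `XSX = diag(i, 1)` and `S⁵ = S`. The factor `S²` is kept apart because it arises as `HXH`,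
which becomes trivial when `X` is switched off. -/
theorem pauliX_phaseS_identity :
    pauliX * phaseS * pauliX * phaseS ^ 3 * phaseS ^ 2 = Complex.I • 1 := by
  rw [Matrix.mul_assoc, ← pow_add]
  ext i j
  fin_cases i <;> fin_cases j <;>
    simp [pauliX, phaseS, pow_succ, Matrix.mul_apply, Fin.sum_univ_two]

theorem blockOn_const_pow {N : ℕ} (t : Fin N) (U : Matrix (Fin 2) (Fin 2) ℂ) (k : ℕ) :
    blockOn t (fun _ => U) ^ k = blockOn t (fun _ => U ^ k) := by
  induction k with
  | zero => simp [blockOn_one]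
  | succ k ih => rw [pow_succ, ih, blockOn_mul (indepOf_const _ _), pow_succ]

/-- The controlled phase gate is a circuit as soon as there is one spare qubit. -/
theorem phaseOn_two_mem {N : ℕ} {a t d : Fin N} (hat : a ≠ t) (had : a ≠ d) (htd : t ≠ d) :
    phaseOn (fun x => x a = 1 ∧ x t = 1) ∈ circuitMonoid N := by
  set p : QBasis N → Prop := fun x => x a = 1 ∧ x t = 1 with hp
  have hpi : IndepOf d p := fun x b => by simp [hp, had, htd]
  have hF : ctrlBlock d p pauliX ∈ circuitMonoid N := ctrlBlock_two_mem hat had htd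
  clear_value p
  have hS := phaseS_mem_circuitMonoid d
  have hH := hadamard_mem_circuitMonoid d
  -- Only the flips are controlled. Where `p` holds the product acts on `d` as the scalar `i`;
  -- elsewhere it collapses to `S S³ H H = 1`.
  have h := mul_mem (mul_mem (mul_mem (mul_mem hF hS) hF) (pow_mem hS 3))
    (mul_mem (mul_mem hH hF) hH)
  rw [blockOn_mul_ctrlBlock_mul hpi hadamard_mul_self, hadamard_mul_pauliX_mul, blockOn_const_pow]
    at h
  rw [← ctrlBlock_I_smul_one d, ← pauliX_phaseS_identity]
  convert h using 1
  classical
  have hi := fun U : Matrix (Fin 2) (Fin 2) ℂ =>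
    hpi.ite (indepOf_const d U) (indepOf_const d (1 : Matrix (Fin 2) (Fin 2) ℂ))
  simp only [ctrlBlock]
  rw [blockOn_mul (indepOf_const _ _), blockOn_mul (hi _), blockOn_mul (indepOf_const _ _),
    blockOn_mul (hi _)]
  congr 1
  ext x : 1
  split_ifs
  · rfl
  · have : phaseS * phaseS ^ 3 = 1 := by
      rw [← pow_succ']
      ext i j
      fin_cases i <;> fin_cases j <;> simp [phaseS, pow_succ, Matrix.mul_apply, Fin.sum_univ_two]
    simp [this]

/-! ### One- and two-level matrices -/

section TwoLevel

variable {ι : Type*} [DecidableEq ι]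

/-- The matrix acting as `U` on the coordinates `x`, `y` and trivially on the others. -/
def twoLevel (x y : ι) (U : Matrix (Fin 2) (Fin 2) ℂ) : Matrix ι ι ℂ := fun a b =>
  if a = x then if b = x then U 0 0 else if b = y then U 0 1 else 0
  else if a = y then if b = x then U 1 0 else if b = y then U 1 1 else 0
  else if a = b then 1 else 0

theorem twoLevel_one {x y : ι} (h : x ≠ y) : twoLevel x y 1 = 1 := by
  ext a b
  simp only [twoLevel, Matrix.one_apply]
  split_ifs <;> simp_all

theorem twoLevel_conjTranspose {x y : ι} (h : x ≠ y) (U : Matrix (Fin 2) (Fin 2) ℂ) :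
    (twoLevel x y U)ᴴ = twoLevel x y Uᴴ := by
  ext a b
  simp only [twoLevel, conjTranspose_apply]
  by_cases h1 : a = x
  · by_cases h2 : b = x
    · simp [h1, h2]
    · by_cases h3 : b = y <;> simp [h1, h2, h3, h.symm]
  · by_cases h4 : a = y
    · by_cases h2 : b = x
      · simp [h4, h2, h.symm]
      · by_cases h3 : b = y <;> simp [h4, h2, h3, h.symm]
    · by_cases h2 : b = x
      · simp [h1, h4, h2]
      · by_cases h3 : b = y
        · simp [h1, h4, h3, h.symm]
        · by_cases h5 : a = b <;> simp [h1, h4, h2, h3, h5, Ne.symm]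

variable [Fintype ι]

theorem sum_twoLevel {x y : ι} (h : x ≠ y) (U : Matrix (Fin 2) (Fin 2) ℂ) (f : ι → ℂ) (a : ι) :
    ∑ b, twoLevel x y U a b * f b =
      if a = x then U 0 0 * f x + U 0 1 * f y else
      if a = y then U 1 0 * f x + U 1 1 * f y else f a := by
  have key : ∀ p q : ℂ, ∑ b, (if b = x then p else if b = y then q else 0) * f b =
      p * f x + q * f y := by
    intro p q
    have : ∀ b, (if b = x then p else if b = y then q else 0) * f b =
        (if b = x then p * f b else 0) + (if b = y then q * f b else 0) := by
      intro b
      by_cases h1 : b = x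
      · subst h1; simp [h]
      · simp [h1]
    simp only [this, Finset.sum_add_distrib, Finset.sum_ite_eq', Finset.mem_univ, if_true]
  unfold twoLevel
  split_ifs
  · exact key _ _
  · exact key _ _
  · simp

theorem twoLevel_mulVec {x y : ι} (h : x ≠ y) (U : Matrix (Fin 2) (Fin 2) ℂ) (f : ι → ℂ) :
    twoLevel x y U *ᵥ f = fun a => if a = x then U 0 0 * f x + U 0 1 * f y else
      if a = y then U 1 0 * f x + U 1 1 * f y else f a := by
  ext a
  exact sum_twoLevel h U f a

theorem twoLevel_mul {x y : ι} (h : x ≠ y) (U V : Matrix (Fin 2) (Fin 2) ℂ) :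
    twoLevel x y U * twoLevel x y V = twoLevel x y (U * V) := by
  ext a b
  rw [Matrix.mul_apply, sum_twoLevel h]
  simp only [twoLevel, if_true, if_neg h.symm, Matrix.mul_apply, Fin.sum_univ_two]
  split_ifs <;> simp

theorem twoLevel_mem_unitary {x y : ι} (h : x ≠ y) {U : Matrix (Fin 2) (Fin 2) ℂ}
    (hU : U ∈ unitaryGroup (Fin 2) ℂ) : twoLevel x y U ∈ unitaryGroup ι ℂ := by
  rw [mem_unitaryGroup_iff, star_eq_conjTranspose, twoLevel_conjTranspose h, twoLevel_mul h,
    ← star_eq_conjTranspose, mem_unitaryGroup_iff.1 hU, twoLevel_one h]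

theorem twoLevel_mem_gaussianForm {x y : ι} {U : Matrix (Fin 2) (Fin 2) ℂ} {c : GaussianInt}
    (hc : GaussianInt.toComplex c ≠ 0) (hU : U ∈ gaussianForm (Fin 2) (GaussianInt.toComplex c)) :
    twoLevel x y U ∈ gaussianForm ι (GaussianInt.toComplex c) := by
  obtain ⟨q, W, rfl⟩ := hU
  refine ⟨q, of fun a b => if a = x then if b = x then W 0 0 else if b = y then W 0 1 else 0
    else if a = y then if b = x then W 1 0 else if b = y then W 1 1 else 0
    else if a = b then c ^ q else 0, ?_⟩
  ext a b
  simp only [twoLevel, Matrix.smul_apply, Matrix.map_apply, of_apply]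
  split_ifs <;> simp [hc]

/-- The diagonal matrix with entry `i` at `x` and `1` elsewhere. -/
def sitePhase (x : ι) : Matrix ι ι ℂ := diagonal (fun z => if z = x then Complex.I else 1)

theorem sitePhase_mem_unitary (x : ι) : sitePhase x ∈ unitaryGroup ι ℂ := by
  rw [mem_unitaryGroup_iff, star_eq_conjTranspose, sitePhase, diagonal_conjTranspose,
    diagonal_mul_diagonal, ← diagonal_one]
  congr 1
  ext z
  by_cases h : z = x <;> simp [h]

theorem star_sitePhase (x : ι) : star (sitePhase x) = sitePhase x ^ 3 := by
  rw [star_eq_conjTranspose, sitePhase, diagonal_conjTranspose, diagonal_pow]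
  congr 1
  ext z
  by_cases h : z = x <;> simp [h]

theorem sitePhase_mem_gaussianForm (x : ι) (c : ℂ) : sitePhase x ∈ gaussianForm ι c := by
  refine ⟨0, diagonal (fun z => if z = x then ⟨0, 1⟩ else 1), ?_⟩
  rw [pow_zero, inv_one, one_smul, sitePhase, diagonal_map (map_zero _)]
  congr 1
  ext z
  by_cases h : z = x <;> simp [h, GaussianInt.toComplex_def]

/-- The matrix `e ^ (i π / 4) H`. -/
def phasedHadamard : Matrix (Fin 2) (Fin 2) ℂ := ((1 + Complex.I) / 2) • !![1, 1; 1, -1]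

theorem phasedHadamard_conjTranspose :
    phasedHadamardᴴ = ((1 - Complex.I) / 2) • !![1, 1; 1, -1] := by
  ext i j
  fin_cases i <;> fin_cases j <;> simp [phasedHadamard, sub_eq_add_neg]

theorem phasedHadamard_mem_unitary : phasedHadamard ∈ unitaryGroup (Fin 2) ℂ := by
  rw [mem_unitaryGroup_iff, star_eq_conjTranspose, phasedHadamard_conjTranspose]
  ext i j
  fin_cases i <;> fin_cases j <;>
    simp [phasedHadamard, Matrix.mul_apply, Fin.sum_univ_two] <;> ring_nf <;> simp <;> norm_num

/-- The Gaussian integer `1 + i`. -/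
def onePlusI : GaussianInt := ⟨1, 1⟩

theorem toComplex_onePlusI : GaussianInt.toComplex onePlusI = 1 + Complex.I := by
  simp [onePlusI, GaussianInt.toComplex_def]

theorem one_add_I_ne_zero : (1 + Complex.I : ℂ) ≠ 0 := by
  intro h
  simpa using congrArg Complex.re h

theorem one_add_I_inv : (1 + Complex.I : ℂ)⁻¹ = (1 - Complex.I) / 2 := by
  refine inv_eq_of_mul_eq_one_right ?_
  ring_nf
  simp
  norm_num

/-- The phase removes `√2` from the Hadamard matrix: `(1 - i)/2` is the inverse of `1 + i`. -/
theorem phasedHadamard_conjTranspose_mem_gaussianForm :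
    phasedHadamardᴴ ∈ gaussianForm (Fin 2) (1 + Complex.I) := by
  refine ⟨1, !![1, 1; 1, -1], ?_⟩
  rw [phasedHadamard_conjTranspose, pow_one, one_add_I_inv]
  congr 1
  ext i j
  fin_cases i <;> fin_cases j <;> simp

/-! ### Column reduction -/

/-- The matrices by which a column supported on `A` may be reduced: unitary matrices over the
Gaussian integers up to powers of `1 + i`, fixing the coordinates outside `A`, with inverse
in `R`. -/
def reducers (R : Submonoid (Matrix ι ι ℂ)) (A : Finset ι) : Submonoid (Matrix ι ι ℂ) where
  carrier := {g | g ∈ unitaryGroup ι ℂ ∧ g ∈ gaussianForm ι (1 + Complex.I) ∧ star g ∈ R ∧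
    ∀ k ∉ A, g *ᵥ Pi.single k 1 = Pi.single k 1}
  one_mem' := ⟨one_mem _, one_mem _, by rw [star_one]; exact one_mem _, fun _ _ => one_mulVec _⟩
  mul_mem' := by
    rintro g h ⟨h1, h2, h3, h4⟩ ⟨k1, k2, k3, k4⟩
    refine ⟨mul_mem h1 k1, mul_mem h2 k2, ?_, fun k hk => ?_⟩
    · rw [star_mul]
      exact mul_mem k3 h3
    · rw [← mulVec_mulVec, k4 k hk, h4 k hk]

/-- The generators `i` at one site, swaps of two sites, and `e ^ (i π / 4) H` at two sites. -/
structure HasLevelGenerators (R : Submonoid (Matrix ι ι ℂ)) : Prop where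
  phase : ∀ x, sitePhase x ∈ R
  swap : ∀ x y, x ≠ y → twoLevel x y pauliX ∈ R
  hadamard : ∀ x y, x ≠ y → twoLevel x y phasedHadamard ∈ R

/-- Some reducer maps the Gaussian integer vector `v` to `w`. -/
def Reduces (R : Submonoid (Matrix ι ι ℂ)) (A : Finset ι) (v w : ι → GaussianInt) : Prop :=
  ∃ g ∈ reducers R A, (g *ᵥ fun k => GaussianInt.toComplex (v k)) =
    fun k => GaussianInt.toComplex (w k)

variable {R : Submonoid (Matrix ι ι ℂ)} {A : Finset ι}

theorem Reduces.refl (v : ι → GaussianInt) : Reduces R A v v := ⟨1, one_mem _, by simp⟩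

theorem Reduces.trans {u v w : ι → GaussianInt} (h : Reduces R A u v) (h' : Reduces R A v w) :
    Reduces R A u w := by
  obtain ⟨g, hg, e⟩ := h
  obtain ⟨g', hg', e'⟩ := h'
  exact ⟨g' * g, mul_mem hg' hg, by rw [← mulVec_mulVec, e, e']⟩

theorem sum_norm_eq_dotProduct {κ : Type*} [Fintype κ] (v : κ → GaussianInt) :
    (((∑ k, (v k).norm : ℤ)) : ℂ) =
      star (fun k => GaussianInt.toComplex (v k)) ⬝ᵥ fun k => GaussianInt.toComplex (v k) := by
  simp only [dotProduct, Pi.star_apply, Int.cast_sum]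
  refine Finset.sum_congr rfl fun k _ => ?_
  rw [GaussianInt.intCast_complex_norm, Complex.normSq_eq_conj_mul_self]
  rfl

theorem Reduces.sum_norm {v w : ι → GaussianInt} (h : Reduces R A v w) :
    ∑ k, (w k).norm = ∑ k, (v k).norm := by
  obtain ⟨g, hg, e⟩ := h
  have hu := mem_unitaryGroup_iff'.1 hg.1
  rw [star_eq_conjTranspose] at hu
  have : (((∑ k, (w k).norm : ℤ)) : ℂ) = ((∑ k, (v k).norm : ℤ) : ℂ) := by
    rw [sum_norm_eq_dotProduct, sum_norm_eq_dotProduct, ← e, star_mulVec, ← dotProduct_mulVec,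
      mulVec_mulVec, hu, one_mulVec]
  exact_mod_cast this

theorem Reduces.phase (hR : HasLevelGenerators R) {y : ι} (hy : y ∈ A) (v : ι → GaussianInt)
    (c : ℕ) : Reduces R A v (update v y (⟨0, 1⟩ ^ c * v y)) := by
  induction c with
  | zero => simpa using Reduces.refl v
  | succ c ih =>
    refine ih.trans ⟨sitePhase y, ⟨sitePhase_mem_unitary y, sitePhase_mem_gaussianForm y _, ?_,
      fun k hk => ?_⟩, ?_⟩
    · rw [star_sitePhase]
      exact pow_mem (hR.phase y) 3
    · ext z
      have : k ≠ y := fun h => hk (h ▸ hy)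
      by_cases hz : z = k
      · subst hz; simp [sitePhase, this, mulVec_diagonal]
      · simp [sitePhase, mulVec_diagonal, hz]
    · have hI : GaussianInt.toComplex ⟨0, 1⟩ = Complex.I := by simp [GaussianInt.toComplex_def]
      ext z
      by_cases hz : z = y
      · subst hz
        simp [sitePhase, mulVec_diagonal, pow_succ', mul_assoc, hI]
      · simp [sitePhase, mulVec_diagonal, hz]

theorem twoLevel_mem_reducers {x y : ι} (hxy : x ≠ y) (hx : x ∈ A) (hy : y ∈ A)
    {U : Matrix (Fin 2) (Fin 2) ℂ} (hU : Uᴴ ∈ unitaryGroup (Fin 2) ℂ)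
    (hf : U ∈ gaussianForm (Fin 2) (1 + Complex.I)) (hR : twoLevel x y Uᴴ ∈ R) :
    twoLevel x y U ∈ reducers R A := by
  refine ⟨twoLevel_mem_unitary hxy ?_, ?_, ?_, fun k hk => ?_⟩
  · have := Unitary.star_mem hU
    rwa [star_eq_conjTranspose, conjTranspose_conjTranspose] at this
  · rw [← toComplex_onePlusI] at hf ⊢
    exact twoLevel_mem_gaussianForm (by rw [toComplex_onePlusI]; exact one_add_I_ne_zero) hf
  · rwa [star_eq_conjTranspose, twoLevel_conjTranspose hxy]
  · have h1 : x ≠ k := fun h => hk (h ▸ hx)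
    have h2 : y ≠ k := fun h => hk (h ▸ hy)
    rw [twoLevel_mulVec hxy]
    ext a
    by_cases ha : a = x
    · subst ha; simp [h1, h2]
    · by_cases hb : a = y
      · subst hb; simp [h1, h2]
      · simp [ha, hb]

theorem Reduces.swap (hR : HasLevelGenerators R) {x y : ι} (hxy : x ≠ y) (hx : x ∈ A) (hy : y ∈ A)
    (v : ι → GaussianInt) :
    Reduces R A v (fun a => if a = x then v y else if a = y then v x else v a) := by
  have hX : pauliXᴴ = pauliX := by
    ext i j
    fin_cases i <;> fin_cases j <;> simp [pauliX]
  refine ⟨twoLevel x y pauliX, twoLevel_mem_reducers hxy hx hy ?_ ?_ ?_, ?_⟩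
  · rw [hX]; exact pauliX_mem_unitary
  · refine ⟨0, !![0, 1; 1, 0], ?_⟩
    ext i j
    fin_cases i <;> fin_cases j <;> simp [pauliX]
  · rw [hX]; exact hR.swap x y hxy
  · rw [twoLevel_mulVec hxy]
    ext a
    simp only [pauliX]
    split_ifs <;> simp

/-- Congruence of the two entries modulo 2 keeps the result integral, and both new entries acquire
the factor `1 - i`, an associate of `1 + i`. -/
theorem Reduces.hadamard (hR : HasLevelGenerators R) {x y : ι} (hxy : x ≠ y) (hx : x ∈ A)
    (hy : y ∈ A) {v : ι → GaussianInt} {a b : GaussianInt} (ha : v x + v y = 2 * a)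
    (hb : v x - v y = 2 * b) :
    Reduces R A v (fun z => if z = x then ⟨1, -1⟩ * a else if z = y then ⟨1, -1⟩ * b else v z) := by
  refine ⟨twoLevel x y phasedHadamardᴴ, twoLevel_mem_reducers hxy hx hy ?_
    phasedHadamard_conjTranspose_mem_gaussianForm ?_, ?_⟩
  · rw [conjTranspose_conjTranspose]; exact phasedHadamard_mem_unitary
  · rw [conjTranspose_conjTranspose]; exact hR.hadamard x y hxy
  · have ha' := congrArg GaussianInt.toComplex ha
    have hb' := congrArg GaussianInt.toComplex hb
    simp only [map_add, map_sub, map_mul, map_ofNat] at ha' hb'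
    have h1 : GaussianInt.toComplex ⟨1, -1⟩ = 1 - Complex.I := by
      simp [GaussianInt.toComplex_def, sub_eq_add_neg]
    rw [twoLevel_mulVec hxy, phasedHadamard_conjTranspose]
    ext z
    by_cases hzx : z = x
    · simp only [hzx, if_true, map_mul, h1]
      simp
      linear_combination ((1 - Complex.I) / 2) * ha'
    by_cases hzy : z = y
    · simp only [hzy, hxy.symm, if_true, if_false, map_mul, h1]
      simp
      linear_combination ((1 - Complex.I) / 2) * hb'
    · simp only [hzx, hzy, if_false]

/-! ### Gaussian integers modulo `1 + i` and modulo `2` -/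

theorem GaussianInt.even_norm_iff (z : GaussianInt) : Even z.norm ↔ Even (z.re + z.im) := by
  have : z.norm = z.re * z.re + z.im * z.im := by rw [Zsqrtd.norm_def]; ring
  rw [this]
  simp only [Int.even_add, Int.even_mul, or_self]

theorem GaussianInt.exists_eq_onePlusI_mul {z : GaussianInt} (h : Even (z.re + z.im)) :
    ∃ w, z = onePlusI * w := by
  obtain ⟨k, hk⟩ := h
  -- With `re + im = 2k`, this is the quotient of `z` by `1 + i`.
  refine ⟨⟨k, k - z.re⟩, ?_⟩
  ext <;> (simp [onePlusI]; try omega)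

/-- Two odd Gaussian integers agree modulo `2` up to a factor `i`. -/
theorem GaussianInt.exists_pow_mul_eq_mod_two {u v : GaussianInt} (hu : ¬Even (u.re + u.im))
    (hv : ¬Even (v.re + v.im)) :
    ∃ (c : ℕ) (a b : GaussianInt), u + ⟨0, 1⟩ ^ c * v = 2 * a ∧ u - ⟨0, 1⟩ ^ c * v = 2 * b := by
  have key : ∀ w : GaussianInt, Even (u.re + w.re) → Even (u.im + w.im) →
      ∃ a b : GaussianInt, u + w = 2 * a ∧ u - w = 2 * b := by
    rintro w ⟨k, hk⟩ ⟨l, hl⟩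
    refine ⟨⟨k, l⟩, ⟨k - w.re, l - w.im⟩, ?_, ?_⟩ <;> ext <;> (simp; omega)
  -- An odd Gaussian integer is `1` or `i` modulo 2, so exponent 0 or 1 suffices, according to
  -- whether the real parts have equal parity.
  by_cases h : Even (u.re + v.re)
  · refine ⟨0, ?_⟩
    rw [pow_zero, one_mul]
    refine key v h ?_
    simp only [Int.even_iff] at *
    omega
  · refine ⟨1, ?_⟩
    rw [pow_one]
    refine key _ ?_ ?_ <;> simp only [Int.even_iff, Zsqrtd.re_mul, Zsqrtd.im_mul] at * <;> omega

theorem GaussianInt.exists_pow_mul_eq_one {z : GaussianInt} (h : z.norm = 1) :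
    ∃ c : ℕ, (⟨0, 1⟩ : GaussianInt) ^ c * z = 1 := by
  have h' : z.re * z.re + z.im * z.im = 1 := by
    linarith [Zsqrtd.norm_def z]
  have hr : z.re * z.re = 0 ∧ z.im * z.im = 1 ∨ z.re * z.re = 1 ∧ z.im * z.im = 0 := by
    have := mul_self_nonneg z.re
    have := mul_self_nonneg z.im
    omega
  obtain ⟨a, b⟩ := z
  rcases hr with ⟨h1, h2⟩ | ⟨h1, h2⟩
  · obtain rfl : a = 0 := by simpa using h1
    rcases mul_self_eq_one_iff.1 h2 with rfl | rfl
    · exact ⟨3, by decide⟩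
    · exact ⟨1, by decide⟩
  · obtain rfl : b = 0 := by simpa using h2
    rcases mul_self_eq_one_iff.1 h1 with rfl | rfl
    · exact ⟨0, by decide⟩
    · exact ⟨2, by decide⟩

/-! ### Reducing one column -/

/-- Induction on the number of odd entries. An even norm sum forbids exactly one odd entry, and a
phase followed by a Hadamard makes a pair of odd entries even without changing the norm sum. -/
theorem exists_reduces_even (hR : HasLevelGenerators R) (v : ι → GaussianInt)
    (hv : ∀ k ∉ A, v k = 0) (he : Even (∑ k, (v k).norm)) :
    ∃ w, Reduces R A v w ∧ (∀ k ∉ A, w k = 0) ∧ ∀ k, Even ((w k).re + (w k).im) := by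
  classical
  induction hn : (Finset.univ.filter fun k => ¬Even ((v k).re + (v k).im)).card
    using Nat.strong_induction_on generalizing v with
  | _ n ih =>
  by_cases hall : ∀ k, Even ((v k).re + (v k).im)
  · exact ⟨v, Reduces.refl v, hv, hall⟩
  push Not at hall
  obtain ⟨x, hx⟩ := hall
  obtain ⟨y, hyx, hy⟩ : ∃ y, y ≠ x ∧ ¬Even ((v y).re + (v y).im) := by
    by_contra! hcon
    rw [← Finset.add_sum_erase _ _ (Finset.mem_univ x), Int.even_add] at he
    refine hx ((GaussianInt.even_norm_iff _).1 (he.2 ?_))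
    refine Finset.even_sum _ fun k hk => (GaussianInt.even_norm_iff _).2 ?_
    exact Int.not_odd_iff_even.1 (by simpa using hcon k (Finset.ne_of_mem_erase hk))
  have hmem : ∀ k, ¬Even ((v k).re + (v k).im) → k ∈ A := by
    intro k hk
    by_contra hkA
    rw [hv k hkA] at hk
    exact hk (by simp)
  obtain ⟨c, a, b, ha, hb⟩ := GaussianInt.exists_pow_mul_eq_mod_two hx hy
  have h1 := Reduces.phase (A := A) hR (hmem y hy) v c
  have h2 := Reduces.hadamard (A := A) hR hyx.symm (hmem x hx) (hmem y hy)
    (v := update v y (⟨0, 1⟩ ^ c * v y)) (a := a) (b := b) (by simpa [hyx.symm] using ha)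
    (by simpa [hyx.symm] using hb)
  have h3 := h1.trans h2
  have he2 : ∀ z : GaussianInt, Even (((⟨1, -1⟩ : GaussianInt) * z).re +
      ((⟨1, -1⟩ : GaussianInt) * z).im) := by
    intro z
    refine ⟨z.im, ?_⟩
    simp
    ring
  set w : ι → GaussianInt := fun z => if z = x then ⟨1, -1⟩ * a else if z = y then ⟨1, -1⟩ * b
    else update v y (⟨0, 1⟩ ^ c * v y) z with hw
  have hwx : w x = ⟨1, -1⟩ * a := by simp [hw]
  have hwz : ∀ z, z ≠ x → z ≠ y → w z = v z := fun z h h' => by simp [hw, h, h']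
  have hlt : (Finset.univ.filter fun k => ¬Even ((w k).re + (w k).im)).card < n := by
    rw [← hn]
    refine Finset.card_lt_card ⟨fun z hz => ?_, fun hsub => ?_⟩
    · simp only [Finset.mem_filter, Finset.mem_univ, true_and] at hz ⊢
      by_cases hzx : z = x
      · rwa [hzx]
      by_cases hzy : z = y
      · rwa [hzy]
      rwa [hwz z hzx hzy] at hz
    · have := hsub (Finset.mem_filter.2 ⟨Finset.mem_univ x, hx⟩)
      rw [Finset.mem_filter, hwx] at this
      exact this.2 (he2 a)
  obtain ⟨u, hu1, hu2, hu3⟩ := ih _ hlt w (fun k hk => by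
    rw [hwz k (fun h => hk (h ▸ hmem x hx)) (fun h => hk (h ▸ hmem y hy)), hv k hk])
    (by rw [h3.sum_norm]; exact he) rfl
  exact ⟨u, h3.trans hu1, hu2, hu3⟩

/-- Nonnegative integers summing to 1 leave one nonzero entry, a power of `i`; a phase and at most
one swap finish. -/
theorem exists_reduces_single (hR : HasLevelGenerators R) {j : ι} (hj : j ∈ A)
    (v : ι → GaussianInt) (hv : ∀ k ∉ A, v k = 0) (h1 : ∑ k, (v k).norm = 1) :
    Reduces R A v (Pi.single j 1) := by
  have hnn : ∀ k, 0 ≤ (v k).norm := fun k => GaussianInt.norm_nonneg _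
  obtain ⟨x, hx⟩ : ∃ x, v x ≠ 0 := by
    by_contra! h
    simp [h] at h1
  have hx0 : 0 < (v x).norm := GaussianInt.norm_pos.2 hx
  have hxA : x ∈ A := by
    by_contra h
    exact hx (hv x h)
  rw [← Finset.add_sum_erase _ _ (Finset.mem_univ x)] at h1
  have hs := Finset.sum_nonneg fun k (_ : k ∈ Finset.univ.erase x) => hnn k
  have hz : ∀ k, k ≠ x → v k = 0 := by
    intro k hk
    have := (Finset.sum_eq_zero_iff_of_nonneg fun k (_ : k ∈ Finset.univ.erase x) => hnn k).1
      (by omega) k (by simp [hk])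
    exact GaussianInt.norm_eq_zero.1 this
  obtain ⟨c, hc⟩ := GaussianInt.exists_pow_mul_eq_one (z := v x) (by omega)
  have h2 := Reduces.phase (A := A) hR hxA v c
  have h3 : update v x (⟨0, 1⟩ ^ c * v x) = Pi.single x 1 := by
    ext k : 1
    by_cases hk : k = x
    · subst hk; simp [hc]
    · simp [hk, hz k hk]
  rw [h3] at h2
  by_cases hxj : x = j
  · rwa [hxj] at h2
  · convert h2.trans (Reduces.swap hR hxj hxA hj _) using 1
    ext k : 1
    by_cases hk : k = x
    · subst hk; simp [hxj]
    · by_cases hkj : k = j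
      · subst hkj; simp [hk]
      · simp [hk, hkj]

/-- Induction on the denominator exponent: once every entry is divisible by `1 + i`, of norm 2,
cancelling this factor lowers `q` by one and halves the norm sum. -/
theorem exists_reducer_single (hR : HasLevelGenerators R) {j : ι} (hj : j ∈ A) (q : ℕ)
    (v : ι → GaussianInt) (hv : ∀ k ∉ A, v k = 0) (h1 : ∑ k, (v k).norm = 2 ^ q) :
    ∃ g ∈ reducers R A, (g *ᵥ fun k => ((1 + Complex.I) ^ q)⁻¹ * GaussianInt.toComplex (v k)) =
      Pi.single j 1 := by
  induction q generalizing v with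
  | zero =>
    obtain ⟨g, hg, e⟩ := exists_reduces_single hR hj v hv (by simpa using h1)
    refine ⟨g, hg, ?_⟩
    simp only [pow_zero, inv_one, one_mul, e]
    ext k
    by_cases hk : k = j
    · subst hk; simp
    · simp [hk]
  | succ q ih =>
    obtain ⟨w, hw, hwA, hwe⟩ := exists_reduces_even hR v hv
      (by rw [h1, pow_succ]; exact even_two.mul_left _)
    choose u hu using fun k => GaussianInt.exists_eq_onePlusI_mul (hwe k)
    have hn : ∀ k, (w k).norm = 2 * (u k).norm := by
      intro k
      rw [hu, Zsqrtd.norm_mul]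
      rfl
    have hsum := hw.sum_norm
    simp only [hn, ← Finset.mul_sum, h1, pow_succ'] at hsum
    obtain ⟨g, hg, e⟩ := ih u (fun k hk => GaussianInt.norm_eq_zero.1 (by
      have := hn k
      rw [hwA k hk] at this
      simpa using this.symm)) (by linarith)
    obtain ⟨g', hg', e'⟩ := hw
    refine ⟨g * g', mul_mem hg hg', ?_⟩
    rw [← mulVec_mulVec, ← e]
    congr 1
    have : (fun k => ((1 + Complex.I) ^ (q + 1))⁻¹ * GaussianInt.toComplex (v k)) =
        ((1 + Complex.I) ^ (q + 1))⁻¹ • fun k => GaussianInt.toComplex (v k) := rfl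
    rw [this, mulVec_smul, e']
    ext k
    have h0 := one_add_I_ne_zero
    simp only [Pi.smul_apply, smul_eq_mul, hu k, map_mul, toComplex_onePlusI]
    field_simp
    ring

/-- Unitary matrices over `ℤ[i]` up to powers of `1 + i` are generated by one- and two-level
matrices. -/
theorem mem_of_hasLevelGenerators (hR : HasLevelGenerators R) (A : Finset ι) {V : Matrix ι ι ℂ}
    (hV : V ∈ unitaryGroup ι ℂ) (hf : V ∈ gaussianForm ι (1 + Complex.I))
    (hA : ∀ k ∉ A, V *ᵥ Pi.single k 1 = Pi.single k 1) : V ∈ R := by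
  induction A using Finset.induction_on generalizing V with
  | empty =>
    have : V = 1 := by
      ext i k
      have := congrFun (hA k (by simp)) i
      rw [mulVec_single_one] at this
      rw [Matrix.one_apply]
      simpa [Pi.single_apply] using this
    rw [this]
    exact one_mem R
  | insert j A hj ih =>
    obtain ⟨q, W, hW⟩ := hf
    have hu := mem_unitaryGroup_iff'.1 hV
    -- A unitary matrix fixing a basis vector has its inverse fixing it too, so the corresponding
    -- row is also trivial.
    have hcol : ∀ k ∉ insert j A, V k j = 0 := by
      intro k hk
      have h1 : star V *ᵥ Pi.single k 1 = Pi.single k 1 := by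
        conv_lhs => rw [← hA k hk]
        rw [mulVec_mulVec, hu, one_mulVec]
      have h2 := congrFun h1 j
      have hjk : j ≠ k := by
        rintro rfl
        simp at hk
      rw [mulVec_single_one] at h2
      simpa [hjk, star_eq_conjTranspose] using h2
    have hp : ((1 + Complex.I : ℂ) ^ q) ≠ 0 := pow_ne_zero _ one_add_I_ne_zero
    have hVW : ∀ k, V k j = ((1 + Complex.I) ^ q)⁻¹ * GaussianInt.toComplex (W k j) := by
      intro k
      rw [hW]
      rfl
    have hsum : ∑ k, (W k j).norm = 2 ^ q := by
      have h1 : (∑ k, star (V k j) * V k j) = 1 := by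
        simpa [Matrix.mul_apply] using congrFun (congrFun hu j) j
      have h2 : (((∑ k, (W k j).norm : ℤ)) : ℂ) = ((2 ^ q : ℤ) : ℂ) := by
        rw [sum_norm_eq_dotProduct]
        have h3 : ∀ k, GaussianInt.toComplex (W k j) = (1 + Complex.I) ^ q * V k j := by
          intro k
          rw [hVW k, mul_inv_cancel_left₀ hp]
        have h4 : star ((1 + Complex.I : ℂ) ^ q) * (1 + Complex.I) ^ q = 2 ^ q := by
          rw [star_pow, ← mul_pow]
          congr 1
          simp
          ring_nf
          simp
          norm_num
        simp only [dotProduct, h3, Pi.star_apply, star_mul]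
        calc ∑ k, star (V k j) * star ((1 + Complex.I : ℂ) ^ q) * ((1 + Complex.I) ^ q * V k j)
            = (star ((1 + Complex.I : ℂ) ^ q) * (1 + Complex.I) ^ q) *
                ∑ k, star (V k j) * V k j := by
              rw [Finset.mul_sum]
              exact Finset.sum_congr rfl fun k _ => by ring
          _ = _ := by rw [h1, h4]; push_cast; ring
      exact_mod_cast h2
    obtain ⟨g, hg, e⟩ := exists_reducer_single hR (Finset.mem_insert_self j A) q
      (fun k => W k j) (fun k hk => by
        have := hVW k
        rw [hcol k hk, eq_comm, mul_eq_zero] at this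
        simpa [hp] using this) hsum
    -- The reducer sends column `j` to the basis vector and leaves the columns already fixed
    -- untouched, so the induction hypothesis applies to `g * V`.
    have hgV : g * V ∈ R := by
      refine ih (mul_mem hg.1 hV) (mul_mem hg.2.1 ⟨q, W, hW⟩) fun k hk => ?_
      rw [← mulVec_mulVec]
      by_cases hkj : k = j
      · subst hkj
        have hVk : V *ᵥ Pi.single k 1 =
            fun i => ((1 + Complex.I) ^ q)⁻¹ * GaussianInt.toComplex (W i k) := by
          rw [mulVec_single_one]
          ext i
          exact hVW i
        rw [hVk, e]
      · have hk' : k ∉ insert j A := by simp [hkj, hk]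
        rw [hA k hk', hg.2.2.2 k hk']
    have : V = star g * (g * V) := by
      rw [← Matrix.mul_assoc, mem_unitaryGroup_iff'.1 hg.1, Matrix.one_mul]
    rw [this]
    exact mul_mem hg.2.2.1 hgV

end TwoLevel

/-! ### The matrices representable with one ancilla -/

/-- The matrices represented by circuits with one clean ancilla. -/
def representableMonoid (n : ℕ) : Submonoid (QMatrix n) where
  carrier := {V | ∃ M ∈ circuitMonoid (n + 1), M * ancillaEmb n 1 = ancillaEmb n 1 * V}
  one_mem' := ⟨1, one_mem _, by rw [Matrix.one_mul, Matrix.mul_one]⟩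
  mul_mem' := by
    rintro V W ⟨M, hM, e⟩ ⟨M', hM', e'⟩
    exact ⟨M * M', mul_mem hM hM', by
      rw [Matrix.mul_assoc, e', ← Matrix.mul_assoc, e, Matrix.mul_assoc]⟩

theorem representableWith_of_mem {n : ℕ} {V : QMatrix n} (h : V ∈ representableMonoid n) :
    RepresentableWith gaussianGateSet 1 V := by
  obtain ⟨_, ⟨D, rfl⟩, hD⟩ := h
  exact ⟨D, (D.represents_iff V).2 hD⟩

theorem diagonal_mem_representableMonoid {n : ℕ} {d : QBasis (n + 1) → ℂ}
    (h : diagonal d ∈ circuitMonoid (n + 1)) :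
    diagonal (fun x : QBasis n => d (Fin.append x 0)) ∈ representableMonoid n := by
  refine ⟨_, h, ?_⟩
  ext w x
  rw [diagonal_mul, mul_diagonal, ancillaEmb]
  split_ifs with hw
  · rw [hw, mul_comm]
  · simp

theorem blockOn_const_mem_representableMonoid {n : ℕ} (t : Fin n)
    {U : Matrix (Fin 2) (Fin 2) ℂ}
    (h : blockOn (Fin.castAdd 1 t) (fun _ => U) ∈ circuitMonoid (n + 1)) :
    blockOn t (fun _ => U) ∈ representableMonoid n := by
  refine ⟨_, h, ?_⟩
  ext w y
  have hw : ∀ x : QBasis n, w = Fin.append x 0 ↔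
      w (Fin.natAdd n 0) = 0 ∧ x = fun i => w (Fin.castAdd 1 i) := by
    intro x
    constructor
    · rintro rfl
      constructor
      · simp
      · ext; simp
    · rintro ⟨h, rfl⟩
      ext j : 1
      refine Fin.addCases (fun i => ?_) (fun i => ?_) j
      · simp
      · rw [Fin.append_right, Subsingleton.elim i 0, h]
        rfl
  have key : (Fin.append y 0 : QBasis (n + 1)) = update w (Fin.castAdd 1 t) (y t) ↔
      w (Fin.natAdd n 0) = 0 ∧ y = update (fun i => w (Fin.castAdd 1 i)) t (y t) := by
    have hne : Fin.natAdd n (0 : Fin 1) ≠ Fin.castAdd 1 t := by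
      intro h
      have := congrArg Fin.val h
      have := t.2
      simp at *
      omega
    constructor
    · intro e
      constructor
      · have := congrFun e (Fin.natAdd n 0)
        rw [Fin.append_right, update_of_ne hne] at this
        exact this.symm
      · ext i : 1
        have := congrFun e (Fin.castAdd 1 i)
        rw [Fin.append_left] at this
        rw [this]
        by_cases hi : i = t
        · subst hi; simp
        · rw [update_of_ne hi, update_of_ne fun h => hi (Fin.castAdd_injective n 1 h)]
    · rintro ⟨h, e⟩
      ext j : 1
      refine Fin.addCases (fun i => ?_) (fun i => ?_) j
      · rw [Fin.append_left, e]
        by_cases hi : i = t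
        · subst hi; simp
        · rw [update_of_ne hi, update_of_ne fun h => hi (Fin.castAdd_injective n 1 h)]
      · rw [Fin.append_right, Subsingleton.elim i 0, update_of_ne hne, h]
        rfl
  have h1 : (blockOn (Fin.castAdd 1 t) (fun _ => U) * ancillaEmb n 1) w y =
      blockOn (Fin.castAdd 1 t) (fun _ => U) w (Fin.append y 0) := by
    simp [Matrix.mul_apply, ancillaEmb]
  have h2 : (ancillaEmb n 1 * blockOn t (fun _ => U)) w y = if w (Fin.natAdd n 0) = 0 then
      blockOn t (fun _ => U) (fun i => w (Fin.castAdd 1 i)) y else 0 := by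
    simp only [Matrix.mul_apply, ancillaEmb, hw]
    by_cases h0 : w (Fin.natAdd n 0) = 0 <;> simp [h0]
  rw [h1, h2]
  simp only [blockOn, Fin.append_left, key]
  by_cases h0 : w (Fin.natAdd n 0) = 0 <;> simp [h0]

/-- The primitive eighth root of unity `e ^ (i π / 4)`. -/
def omega8 : ℂ := (1 + Complex.I) * ((Real.sqrt 2 : ℝ) : ℂ)⁻¹

/-- This relation is the source of the global phase: applied to any one wire, it multiplies the
whole state by `e^(iπ/4)`. -/
theorem hadamard_phaseS_pow_three : (hadamardH * phaseS) ^ 3 = omega8 • 1 := by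
  have h3 : hadamardH * phaseS = ((Real.sqrt 2 : ℝ) : ℂ)⁻¹ • !![1, Complex.I; 1, -Complex.I] := by
    ext i j
    fin_cases i <;> fin_cases j <;>
      simp [hadamardH, phaseS, Matrix.mul_apply, Fin.sum_univ_two]
  have h4 : (((Real.sqrt 2 : ℝ) : ℂ)⁻¹) ^ 3 = 2⁻¹ * ((Real.sqrt 2 : ℝ) : ℂ)⁻¹ := by
    rw [pow_succ, pow_two, ofReal_sqrt_two_inv_sq]
  rw [h3, smul_pow, h4, omega8]
  ext i j
  fin_cases i <;> fin_cases j <;>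
    (simp [pow_succ]; try ring_nf; try simp; try ring)

/-- The scalar is produced on the ancilla, so it is available even when `n = 0`. -/
theorem omega8_smul_one_mem (n : ℕ) : omega8 • (1 : QMatrix n) ∈ representableMonoid n := by
  have h := pow_mem (mul_mem (hadamard_mem_circuitMonoid (Fin.last n))
    (phaseS_mem_circuitMonoid (Fin.last n))) 3
  rw [blockOn_mul (indepOf_const _ _), blockOn_const_pow, hadamard_phaseS_pow_three,
    blockOn_smul_one _ (fun _ => omega8)] at h
  rw [smul_one_eq_diagonal]
  exact diagonal_mem_representableMonoid (d := fun _ => omega8) h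

theorem omega8_sq : omega8 ^ 2 = Complex.I := by
  rw [omega8, mul_pow, pow_two _⁻¹, ofReal_sqrt_two_inv_sq]
  ring_nf
  simp

theorem pauliX_mem_representableMonoid {n : ℕ} (t : Fin n) :
    blockOn t (fun _ => pauliX) ∈ representableMonoid n :=
  blockOn_const_mem_representableMonoid t (pauliX_mem_circuitMonoid _)

theorem hadamard_mem_representableMonoid {n : ℕ} (t : Fin n) :
    blockOn t (fun _ => hadamardH) ∈ representableMonoid n :=
  blockOn_const_mem_representableMonoid t (hadamard_mem_circuitMonoid _)

/-- The conjunction of all bits but bit 0 is computed into the ancilla, a controlled `S` acts on the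
ancilla and bit 0, and the conjunction is uncomputed. The flip borrows bit 0 as spare qubit and the
controlled `S` borrows bit 1. -/
theorem phaseOn_allOne_mem (n : ℕ) :
    (phaseOn (AllOne Finset.univ) : QMatrix n) ∈ representableMonoid n := by
  classical
  -- The borrowing needs two data qubits. For `n = 0` the matrix is the scalar `i = ω²`, and for `n
  -- = 1` it is `S` itself.
  rcases n with _ | _ | n
  · convert pow_mem (omega8_smul_one_mem 0) 2 using 1
    rw [smul_pow, omega8_sq, one_pow, smul_one_eq_diagonal, phaseOn]
    congr 1
    ext x
    simp [AllOne]
  · have h := blockOn_const_mem_representableMonoid (0 : Fin 1) (phaseS_mem_circuitMonoid _)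
    rw [← ctrlBlock_true, ctrlBlock_phaseS] at h
    convert h using 2
    ext x
    simp [AllOne]
  · set C : Finset (Fin (n + 3)) := (Finset.univ.erase (0 : Fin (n + 2))).map (Fin.castAddEmb 1)
      with hC
    set a : Fin (n + 3) := Fin.natAdd (n + 2) (0 : Fin 1) with ha
    set t : Fin (n + 3) := Fin.castAdd 1 (0 : Fin (n + 2)) with ht
    set d : Fin (n + 3) := Fin.castAdd 1 (1 : Fin (n + 2)) with hd
    have haC : a ∉ C := by
      simp only [hC, ha, Finset.mem_map, not_exists, not_and]
      intro x _ h
      have := congrArg Fin.val h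
      have := x.2
      simp at *
      omega
    have htC : t ∉ C := by
      simp only [hC, ht, Finset.mem_map, not_exists, not_and]
      intro x hx h
      exact (Finset.mem_erase.1 hx).1 (Fin.castAdd_injective _ 1 h)
    have hta : t ≠ a := by
      intro h
      have := congrArg Fin.val h
      simp [ht, ha] at this
    have hda : d ≠ a := by
      intro h
      have := congrArg Fin.val h
      simp [hd, ha] at this
    have htd : t ≠ d := by
      intro h
      have := congrArg Fin.val h
      simp [ht, hd] at this
    have h1 := ctrlBlock_allOne_mem C a t haC htC hta
    have h2 := phaseOn_two_mem hta.symm hda.symm htd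
    have h3 := mul_mem (mul_mem h1 h2) h1
    rw [ctrlBlock_pauliX, funMatrix_mul_phaseOn_mul (ctrlFlip_involutive (indepOf_allOne haC))]
      at h3
    convert diagonal_mem_representableMonoid h3 using 1
    rw [phaseOn]
    congr 1
    ext x
    set w : QBasis (n + 3) := Fin.append (m := n + 2) (n := 1) x 0 with hw
    have hwa : w a = 0 := Fin.append_right _ _ _
    have hwx : ∀ j : Fin (n + 2), w (Fin.castAdd 1 j) = x j := fun j => Fin.append_left _ _ _
    have e1 : AllOne C w ↔ ∀ j, j ≠ 0 → x j = 1 := by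
      simp only [AllOne, hC, Finset.forall_mem_map]
      simp [hwx]
    have e2 : ctrlFlip a (AllOne C) w a = 1 ↔
        AllOne C w := by
      by_cases h : AllOne C w
      · simp [ctrlFlip, h, hwa]
      · simp [ctrlFlip, h, hwa]
    have e3 : AllOne Finset.univ x ↔ ctrlFlip a (AllOne C) w a = 1 ∧
        ctrlFlip a (AllOne C) w t = 1 := by
      rw [e2, e1, ctrlFlip_apply_of_ne hta, ht, hwx]
      constructor
      · intro h
        exact ⟨fun j _ => h j (Finset.mem_univ j), h 0 (Finset.mem_univ 0)⟩
      · rintro ⟨h, h0⟩ j _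
        by_cases hj : j = 0
        · rw [hj, h0]
        · exact h j hj
    by_cases h : AllOne Finset.univ x
    · rw [if_pos h, if_pos (e3.1 h)]
    · rw [if_neg h, if_neg (fun h' => h (e3.2 h'))]

/-- Any two basis states are connected by bit flips. -/
theorem QBasis.flip_induction {n : ℕ} {p : QBasis n → Prop}
    (h : ∀ x t, p x → p (update x t (x t + 1))) {x : QBasis n} (hx : p x) (y : QBasis n) : p y := by
  classical
  have key : ∀ s : Finset (Fin n), p (s.piecewise y x) := by
    intro s
    induction s using Finset.induction_on with
    | empty => simpa using hx
    | insert j s _ ih =>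
      rw [Finset.piecewise_insert]
      have h2 : ∀ a b : Fin 2, a = b ∨ a = b + 1 := by decide
      rcases h2 (y j) (s.piecewise y x j) with e | e
      · rwa [e, update_eq_self]
      · rw [e]
        exact h _ j ih
  simpa using key Finset.univ

/-! ### One-level phases and two-level matrices with one ancilla -/

theorem sitePhase_eq_phaseOn {n : ℕ} (x : QBasis n) : sitePhase x = phaseOn (fun z => z = x) := by
  rw [sitePhase, phaseOn]
  congr 1
  ext z
  congr

/-- Conjugation by `X` on a qubit moves the distinguished site along that bit, starting from the
all-ones state. -/
theorem sitePhase_mem_representableMonoid {n : ℕ} (x : QBasis n) :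
    sitePhase x ∈ representableMonoid n := by
  refine QBasis.flip_induction (p := fun x => sitePhase x ∈ representableMonoid n)
    (x := fun _ => 1) (fun x t h => ?_) ?_ x
  · have hX := pauliX_mem_representableMonoid t
    have h1 := mul_mem (mul_mem hX h) hX
    have hi : Involutive (ctrlFlip t fun _ => True) := ctrlFlip_involutive (indepOf_const t True)
    rw [← ctrlBlock_true, ctrlBlock_pauliX, sitePhase_eq_phaseOn, funMatrix_mul_phaseOn_mul hi] at h1
    change sitePhase _ ∈ _
    rw [sitePhase_eq_phaseOn]
    convert h1 using 2
    ext z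
    have hx : update x t (x t + 1) = ctrlFlip t (fun _ => True) x := by simp [ctrlFlip]
    rw [hx]
    constructor
    · rintro rfl; exact hi x
    · rintro rfl; exact (hi z).symm
  · convert phaseOn_allOne_mem n using 1
    rw [sitePhase_eq_phaseOn]
    congr 1
    ext z
    simp [AllOne, funext_iff]

/-- Resetting bit `t` before comparing with `x` makes the control independent of `t`, and exactly
two basis states pass it. -/
theorem ctrlBlock_eq_twoLevel {n : ℕ} {x : QBasis n} {t : Fin n} (hx : x t = 0)
    (U : Matrix (Fin 2) (Fin 2) ℂ) :
    ctrlBlock t (fun z => update z t 0 = x) U = twoLevel x (update x t 1) U := by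
  classical
  have h2 : ∀ c : Fin 2, c = 0 ∨ c = 1 := by decide
  have hz : ∀ z : QBasis n, update z t 0 = x ↔ z = x ∨ z = update x t 1 := by
    intro z
    constructor
    · rintro rfl
      rcases h2 (z t) with e | e
      · left; rw [← e, update_eq_self]
      · right; rw [update_idem, ← e, update_eq_self]
    · rintro (rfl | rfl)
      · rw [← hx, update_eq_self]
      · rw [update_idem, ← hx, update_eq_self]
  have hne : x ≠ update x t 1 := by
    intro h
    have := congrFun h t
    rw [hx, update_self] at this
    exact absurd this (by decide)
  have hx0 : update x t 0 = x := (hz x).2 (Or.inl rfl)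
  ext a b
  have key : ∀ i c : Fin 2, (if b = update x t (b t) then U i (b t) else 0) =
      if b = x then U i 0 else if b = update x t 1 then U i 1 else 0 := by
    intro i _
    rcases h2 (b t) with e | e
    · rw [e, hx0]
      by_cases hb : b = x
      · simp [hb]
      · have : b ≠ update x t 1 := by
          rintro rfl
          simp at e
        simp [hb, this]
    · rw [e]
      have : b ≠ x := by
        rintro rfl
        rw [hx] at e
        exact absurd e (by decide)
      simp [this]
  simp only [ctrlBlock, blockOn, twoLevel, hz]
  by_cases ha : a = x
  · subst ha
    simp only [true_or, if_true, hx]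
    exact key 0 0
  · by_cases ha' : a = update x t 1
    · subst ha'
      simp only [or_true, if_true, hne.symm, if_false, update_self, update_idem]
      exact key 1 0
    · have := congrFun (congrFun (blockOn_one t) a) b
      simp only [blockOn] at this
      simp only [ha, ha', or_self, if_false]
      rw [this, Matrix.one_apply]

theorem phaseS_hadamard_identity :
    phaseS * (hadamardH * phaseS * hadamardH) * phaseS = phasedHadamard := by
  have h : hadamardH * phaseS * hadamardH = (2⁻¹ : ℂ) •
      !![1 + Complex.I, 1 - Complex.I; 1 - Complex.I, 1 + Complex.I] := by
    rw [hadamardH, Matrix.smul_mul, Matrix.smul_mul, Matrix.mul_smul, smul_smul,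
      ofReal_sqrt_two_inv_sq]
    congr 1
    ext i j
    fin_cases i <;> fin_cases j <;> simp [phaseS, sub_eq_add_neg]
  rw [h]
  ext i j
  fin_cases i <;> fin_cases j <;>
    simp [phaseS, phasedHadamard, Matrix.mul_apply, Fin.sum_univ_two] <;> ring_nf <;>
    (try simp) <;> ring

theorem twoLevel_phaseS {ι : Type*} [DecidableEq ι] {x y : ι} (h : x ≠ y) :
    twoLevel x y phaseS = sitePhase y := by
  ext a b
  simp only [twoLevel, sitePhase, phaseS, diagonal_apply]
  by_cases ha : a = x
  · subst ha
    by_cases hb : b = a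
    · subst hb; simp [h]
    · simp [hb, Ne.symm hb]
  · by_cases ha' : a = y
    · subst ha'
      by_cases hb : b = x
      · simp [hb, h.symm]
      · by_cases hb' : b = a
        · simp [hb', h.symm]
        · simp [hb, hb', Ne.symm hb']
    · simp [ha, ha']

/-- In `S(HSH)S = ωH` only the `S` factors need control: the uncontrolled Hadamards cancel wherever
the control fails. -/
theorem twoLevel_adjacent_phasedHadamard_mem {n : ℕ} {x : QBasis n} {t : Fin n} (hx : x t = 0) :
    twoLevel x (update x t 1) phasedHadamard ∈ representableMonoid n := by
  have hne : x ≠ update x t 1 := by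
    intro h
    have := congrFun h t
    rw [hx, update_self] at this
    exact absurd this (by decide)
  have hi : IndepOf t (fun z : QBasis n => update z t 0 = x) := fun z b => by
    simp only [update_idem]
  have hP := sitePhase_mem_representableMonoid (update x t 1)
  rw [← twoLevel_phaseS hne, ← ctrlBlock_eq_twoLevel hx] at hP
  have hH := hadamard_mem_representableMonoid t
  have h := mul_mem (mul_mem hP (mul_mem (mul_mem hH hP) hH)) hP
  rw [blockOn_mul_ctrlBlock_mul hi hadamard_mul_self, ctrlBlock_mul hi, ctrlBlock_mul hi,
    phaseS_hadamard_identity, ctrlBlock_eq_twoLevel hx] at h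
  exact h

theorem phasedHadamard_sq : phasedHadamard * phasedHadamard = Complex.I • 1 := by
  ext i j
  fin_cases i <;> fin_cases j <;>
    simp [phasedHadamard, Matrix.mul_apply, Fin.sum_univ_two] <;> ring_nf <;> simp

theorem phasedHadamard_conj_phaseS :
    phasedHadamard * (phaseS * phaseS) * phasedHadamard = Complex.I • pauliX := by
  ext i j
  fin_cases i <;> fin_cases j <;>
    simp [phasedHadamard, phaseS, pauliX, Matrix.mul_apply, Fin.sum_univ_two] <;> ring_nf <;> simp

theorem twoLevel_pauliX_mem {ι : Type*} [Fintype ι] [DecidableEq ι] {R : Submonoid (Matrix ι ι ℂ)}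
    {x y : ι} (h : x ≠ y) (h1 : twoLevel x y phasedHadamard ∈ R) (h2 : sitePhase y ∈ R) :
    twoLevel x y pauliX ∈ R := by
  rw [← twoLevel_phaseS h] at h2
  have hI := mul_mem h1 h1
  -- With `P` the phased Hadamard, `P S² P = iX` and `P² = i`; the last factor `P⁶ = i³` removes the
  -- phase.
  have := mul_mem (mul_mem (mul_mem h1 (mul_mem h2 h2)) h1) (mul_mem hI (mul_mem hI hI))
  simp only [twoLevel_mul h, phasedHadamard_sq, phasedHadamard_conj_phaseS] at this
  convert this using 2
  simp [smul_smul]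

theorem twoLevel_pauliX_apply {ι : Type*} [DecidableEq ι] {x y : ι} (h : x ≠ y) (a b : ι) :
    twoLevel x y pauliX a b = if b = Equiv.swap x y a then 1 else 0 := by
  simp only [twoLevel, pauliX]
  by_cases ha : a = x
  · subst ha
    by_cases hb : b = a
    · subst hb; simp [h]
    · simp [hb]
  · by_cases ha' : a = y
    · subst ha'
      by_cases hb : b = x
      · simp [hb, h.symm]
      · simp [hb, h.symm]
    · simp [ha, ha', Equiv.swap_apply_of_ne_of_ne, eq_comm]

theorem twoLevel_pauliX_comm {ι : Type*} [DecidableEq ι] {x y : ι} (h : x ≠ y) :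
    twoLevel x y pauliX = twoLevel y x pauliX := by
  ext a b
  rw [twoLevel_pauliX_apply h, twoLevel_pauliX_apply h.symm, Equiv.swap_comm]

theorem twoLevel_pauliX_conj {ι : Type*} [Fintype ι] [DecidableEq ι] {p q : ι} (h : p ≠ q)
    (x y : ι) (U : Matrix (Fin 2) (Fin 2) ℂ) :
    twoLevel p q pauliX * twoLevel x y U * twoLevel p q pauliX =
      twoLevel (Equiv.swap p q x) (Equiv.swap p q y) U := by
  have hs : ∀ c d, c = Equiv.swap p q d ↔ Equiv.swap p q c = d := by
    intro c d
    rw [← Equiv.symm_apply_eq, Equiv.symm_swap]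
  have hl : ∀ (M : Matrix ι ι ℂ) a b, (twoLevel p q pauliX * M) a b = M (Equiv.swap p q a) b := by
    intro M a b
    simp [Matrix.mul_apply, twoLevel_pauliX_apply h]
  have hr : ∀ (M : Matrix ι ι ℂ) a b, (M * twoLevel p q pauliX) a b = M a (Equiv.swap p q b) := by
    intro M a b
    simp only [Matrix.mul_apply, twoLevel_pauliX_apply h, hs b]
    simp
  ext a b
  rw [hr, hl]
  unfold twoLevel
  simp only [hs, Equiv.swap_apply_self]

theorem twoLevel_swap_mem {ι : Type*} [Fintype ι] [DecidableEq ι] {R : Submonoid (Matrix ι ι ℂ)}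
    {x y p q : ι} {U : Matrix (Fin 2) (Fin 2) ℂ} (h : twoLevel x y U ∈ R)
    (hpq : p ≠ q → twoLevel p q pauliX ∈ R) :
    twoLevel (Equiv.swap p q x) (Equiv.swap p q y) U ∈ R := by
  by_cases e : p = q
  · subst e
    simpa using h
  · rw [← twoLevel_pauliX_conj e]
    exact mul_mem (mul_mem (hpq e) h) (hpq e)

theorem update_add_one_ne {n : ℕ} (x : QBasis n) (t : Fin n) : x ≠ update x t (x t + 1) := by
  intro h
  have h2 : ∀ b : Fin 2, b ≠ b + 1 := by decide
  have := congrFun h t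
  rw [update_self] at this
  exact h2 _ this

theorem twoLevel_adjacent_pauliX_mem {n : ℕ} (x : QBasis n) (t : Fin n) :
    twoLevel x (update x t (x t + 1)) pauliX ∈ representableMonoid n := by
  have key : ∀ z : QBasis n, z t = 0 → twoLevel z (update z t 1) pauliX ∈ representableMonoid n := by
    intro z hz
    have hne := update_add_one_ne z t
    rw [hz, zero_add] at hne
    exact twoLevel_pauliX_mem hne (twoLevel_adjacent_phasedHadamard_mem hz)
      (sitePhase_mem_representableMonoid _)
  have h2 : ∀ b : Fin 2, b = 0 ∨ b = 1 := by decide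
  rcases h2 (x t) with e | e
  · rw [e]
    exact key x e
  · have h := key (update x t 0) (by simp)
    rw [update_idem, ← e, update_eq_self] at h
    rw [twoLevel_pauliX_comm (update_add_one_ne x t), e]
    exact h

/-- Walk from `x` by single bit flips: conjugating the swap of `x` and `z` by the swap of `z` with
its neighbour gives the swap of `x` with that neighbour. -/
theorem twoLevel_pauliX_mem_representableMonoid {n : ℕ} {x y : QBasis n} (hxy : x ≠ y) :
    twoLevel x y pauliX ∈ representableMonoid n := by
  refine QBasis.flip_induction
    (p := fun z => x ≠ z → twoLevel x z pauliX ∈ representableMonoid n)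
    (x := x) (fun z t h hz => ?_) (fun h => absurd rfl h) y hxy
  have hadj := twoLevel_adjacent_pauliX_mem z t
  by_cases e : x = z
  · rw [e]
    exact hadj
  · have := twoLevel_swap_mem (h e) (fun _ => hadj)
    rwa [Equiv.swap_apply_of_ne_of_ne e hz, Equiv.swap_apply_left] at this

theorem twoLevel_phasedHadamard_mem_representableMonoid {n : ℕ} {x y : QBasis n} (hxy : x ≠ y) :
    twoLevel x y phasedHadamard ∈ representableMonoid n := by
  obtain ⟨t, _⟩ := Function.ne_iff.1 hxy
  -- Any pair differing in one bit would do as a start; one swap carries its first element to `x`,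
  -- and a second carries the image of the other to `y` without moving `x`.
  set a := update x t 0 with ha
  have hne : a ≠ update a t 1 := by
    have := update_add_one_ne a t
    rwa [ha, update_self, zero_add] at this
  have h := twoLevel_adjacent_phasedHadamard_mem (x := a) (t := t) (by simp [ha])
  have h1 := twoLevel_swap_mem (p := a) (q := x) h twoLevel_pauliX_mem_representableMonoid
  rw [Equiv.swap_apply_left] at h1
  set b := Equiv.swap a x (update a t 1) with hb
  have hxb : x ≠ b := by
    rw [hb]
    intro e
    apply hne
    apply (Equiv.swap a x).injective
    rw [Equiv.swap_apply_left, ← e]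
  have h2 := twoLevel_swap_mem (p := b) (q := y) h1 twoLevel_pauliX_mem_representableMonoid
  rwa [Equiv.swap_apply_left, Equiv.swap_apply_of_ne_of_ne hxb hxy] at h2

theorem hasLevelGenerators_representableMonoid (n : ℕ) :
    HasLevelGenerators (representableMonoid n) where
  phase := sitePhase_mem_representableMonoid
  swap _ _ := twoLevel_pauliX_mem_representableMonoid
  hadamard _ _ := twoLevel_phasedHadamard_mem_representableMonoid

/-! ### From denominators `√2` to denominators `1 + i` -/

/-- Multiplying `V` by `ω^(-q)` turns `√2^q` into `(1 + i)^q` with the same numerator `W`, so column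
reduction applies. The scalar `ω^q` is restored afterwards, being itself representable. -/
theorem mem_representableMonoid_of_gaussianForm {n : ℕ} {V : QMatrix n}
    (hV : V ∈ unitaryGroup (QBasis n) ℂ)
    (hf : V ∈ gaussianForm (QBasis n) ((Real.sqrt 2 : ℝ) : ℂ)) : V ∈ representableMonoid n := by
  obtain ⟨q, W, hW⟩ := hf
  have hs : ((Real.sqrt 2 : ℝ) : ℂ) ≠ 0 := by simp
  have h0 := one_add_I_ne_zero
  have hω : star omega8 * omega8 = 1 := by
    have : star omega8 * omega8 =
        ((1 - Complex.I) * (1 + Complex.I)) *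
          (((Real.sqrt 2 : ℝ) : ℂ)⁻¹ * ((Real.sqrt 2 : ℝ) : ℂ)⁻¹) := by
      simp [omega8]
      ring
    rw [this, ofReal_sqrt_two_inv_sq]
    ring_nf
    simp
    norm_num
  have hω' : star omega8 ^ q * omega8 ^ q = 1 := by rw [← mul_pow, hω, one_pow]
  have h1 : star omega8 ^ q • V ∈ representableMonoid n := by
    refine mem_of_hasLevelGenerators (hasLevelGenerators_representableMonoid n) Finset.univ ?_
      ⟨q, W, ?_⟩ (by simp)
    · rw [mem_unitaryGroup_iff', star_smul, Matrix.smul_mul, Matrix.mul_smul, smul_smul,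
        mem_unitaryGroup_iff'.1 hV, star_pow, star_star, mul_comm, hω', one_smul]
    · rw [hW, smul_smul]
      congr 1
      rw [eq_inv_of_mul_eq_one_left hω', ← mul_inv, ← mul_pow, omega8, inv_mul_cancel_right₀ hs]
  have h2 := mul_mem (pow_mem (omega8_smul_one_mem n) q) h1
  rwa [smul_pow, one_pow, Matrix.smul_mul, Matrix.one_mul, smul_smul, mul_comm, hω', one_smul]
    at h2

theorem mainTheorem8 (n : ℕ) (V : QMatrix n) :
    (Representable gaussianGateSet V ↔
      V ∈ Matrix.unitaryGroup (QBasis n) ℂ ∧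
        ∃ (q : ℕ) (W : Matrix (QBasis n) (QBasis n) GaussianInt),
          V = (((Real.sqrt 2 : ℝ) : ℂ) ^ q)⁻¹ • W.map GaussianInt.toComplex) ∧
    (Representable gaussianGateSet V → RepresentableWith gaussianGateSet 1 V) := by
  refine ⟨⟨isUnitary_and_gaussianForm_of_representable, fun h =>
    ⟨1, representableWith_of_mem (mem_representableMonoid_of_gaussianForm h.1 h.2)⟩⟩, fun h => ?_⟩
  have h' := isUnitary_and_gaussianForm_of_representable h
  exact representableWith_of_mem (mem_representableMonoid_of_gaussianForm h'.1 h'.2)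

end
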